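/- Let $S$ be a positive semifield: a semiring $(S,+,\cdot,0,1)$, not necessarily commutative, such that $a+b=0$ implies $a=b=0$, and every $a\neq 0$ has some $b$ with $ab=ba=1$. **The monad.** For a set $X$ let $\mathcal S X$ be the free left $S$-semimodule of finitely supported functions $\varphi\colon X\to S$; for $f\colon X\to Y$ let $\mathcal S(f)(\varphi)(y)=\sum_{f(x)=y}\varphi(x)$; let $\Delta_x\in\mathcal S X$ be the Dirac function at $x$, and let $\mu^{\mathcal S}_X\colon \mathcal S\mathcal S X\to\mathcal S X$ be $\mu^{\mathcal S}_X(\Psi)=\sum_{\varphi}\Psi(\varphi)\cdot\varphi$. The convex closure of a subset $A$ of a left $S$-semimodule is $\overline A=\{\sum_{i=1}^n\lambda_i\cdot a_i : n\in\mathbb N,\ a_i\in A,\ \lambda_i\in S,\ \sum_{i=1}^n\lambda_i=1\}$; $A$ is convex if $A=\overline A$, and a convex set is finitely generated if it is the convex closure of a finite set. Let $\mathcal P_{cf}\mathcal S X$ be the set of finitely generated convex subsets of $\mathcal S X$. It is a monad on $\mathrm{Set}$ with $$\mathcal P_{cf}\mathcal S(f)(A)=\{\mathcal S(f)(\varphi):\varphi\in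 A\},\qquad \eta_X(x)=\{\Delta_x\},\qquad \mu_X(\mathscr A)=\bigcup_{\Omega\in\mathscr A}\{\mu^{\mathcal S}_X(\Psi):\Psi\in c(\Omega)\},$$ where, for $\Omega\in\mathcal S(\mathcal P_{cf}\mathcal S X)$, $c(\Omega)$ is the set of all $\mathcal S(u)(\Omega|_{\operatorname{supp}\Omega})$ with $u\colon\operatorname{supp}\Omega\to\mathcal S X$ such that $u(A)\in A$ for all $A\in\operatorname{supp}\Omega$. **The theory.** Let $(\Sigma',E')$ be the finitary algebraic theory with operations $\sqcup$ and $+$ (binary), $\bot$ and $0$ (constants), and $\lambda\cdot{}$ (unary, one for each $\lambda\in S$), and with the following equations, for all $\lambda,\mu\in S$: - semilattices: $(x\sqcup y)\sqcup z=x\sqcup(y\sqcup z)$, $x\sqcup y=y\sqcup x$, $x\sqcup\bot=x$, $x\sqcup x=x$; - left $S$-semimodules: $(x+y)+z=x+(y+z)$, $x+y=y+x$, $x+0=x$, $\lambda\cdot 0=0$, $0_S\cdot x=0$, $1_S\cdot x=x$, $(\lambda\mu)\cdot x=\lambda\cdot(\mu\cdot x)$, $\lambda\cdot(x+y)=\lambda\cdot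 x+\lambda\cdot y$, $(\lambda+\mu)\cdot x=\lambda\cdot x+\mu\cdot x$; - distributivity: $\lambda\cdot\bot=\bot$ for $\lambda\neq 0_S$, $x+\bot=\bot$, $\lambda\cdot(x\sqcup y)=(\lambda\cdot x)\sqcup(\lambda\cdot y)$, $x+(y\sqcup z)=(x+y)\sqcup(x+z)$. Let $T_{\Sigma',E'}$ be its term monad on $\mathrm{Set}$: $T_{\Sigma',E'}(X)$ is the set of $\Sigma'$-terms with variables in $X$ modulo the equations derivable from $E'$, functions act by renaming variables, the unit sends $x$ to the term $x$, and the multiplication is substitution of terms for variables. **Theorem.** The monads $T_{\Sigma',E'}$ and $\mathcal P_{cf}\mathcal S$ are isomorphic. Therefore $(\Sigma',E')$ presents the monad $\mathcal P_{cf}\mathcal S$: the category of Eilenberg–Moore algebras of $\mathcal P_{cf}\mathcal S$ is isomorphic to the category of $(\Sigma',E')$-algebras and homomorphisms, by an isomorphism that commutes with the forgetful functors to $\mathrm{Set}$. -/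

import Mathlib

open CategoryTheory
open scoped FirstOrder

universe u

/-! ## Finitary algebraic theories, their algebras and their term monads -/

/-- A finitary algebraic theory: a signature (a first-order language without relation symbols)
together with a set of equations between terms with variables in `ℕ`. -/
structure AlgTheory where
  sig : FirstOrder.Language.{u, 0}
  algebraic : sig.IsAlgebraic
  eqs : Set (sig.Term ℕ × sig.Term ℕ)

namespace AlgTheory

variable (T : AlgTheory.{u})

instance : T.sig.IsAlgebraic := T.algebraic

/-- A structure satisfies the equations of the theory. -/
def Satisfies (A : Type u) [T.sig.Structure A] : Prop :=
  ∀ e ∈ T.eqs, ∀ v : ℕ → A, e.1.realize v = e.2.realize v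

/-- The algebras of a theory. -/
structure Alg where
  carrier : Type u
  str : T.sig.Structure carrier
  sat : T.Satisfies carrier

instance (A : T.Alg) : T.sig.Structure A.carrier := A.str

/-- The category of algebras and homomorphisms of a theory. -/
instance : Category T.Alg where
  Hom A B := A.carrier →[T.sig] B.carrier
  id A := FirstOrder.Language.Hom.id T.sig A.carrier
  comp f g := g.comp f

/-- The underlying-set functor. -/
def forgetAlg : T.Alg ⥤ Type u where
  obj A := A.carrier
  map {A B} f := ↾(show A.carrier →[T.sig] B.carrier from f)

/-- Provable equality of terms with variables in `X`: the least congruence containing all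
substitution instances of the equations of the theory. -/
inductive Provable (X : Type u) : T.sig.Term X → T.sig.Term X → Prop
  | refl (t) : Provable X t t
  | symm {s t} : Provable X s t → Provable X t s
  | trans {s t r} : Provable X s t → Provable X t r → Provable X s r
  | congr {n : ℕ} (o : T.sig.Functions n) {s t : Fin n → T.sig.Term X} :
      (∀ i, Provable X (s i) (t i)) → Provable X (.func o s) (.func o t)
  | ax {e : T.sig.Term ℕ × T.sig.Term ℕ} (he : e ∈ T.eqs) (σ : ℕ → T.sig.Term X) :
      Provable X (e.1.subst σ) (e.2.subst σ)

/-- Provable equality as a setoid. -/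
def termSetoid (X : Type u) : Setoid (T.sig.Term X) where
  r := T.Provable X
  iseqv := ⟨.refl, .symm, .trans⟩

/-- Terms with variables in `X` modulo the equations of the theory. -/
def FreeAlg (X : Type u) : Type u := Quotient (T.termSetoid X)

variable {T}

/-- The class of a term. -/
def FreeAlg.mk {X : Type u} (t : T.sig.Term X) : T.FreeAlg X := Quotient.mk (T.termSetoid X) t

theorem FreeAlg.sound {X : Type u} {s t : T.sig.Term X} (h : T.Provable X s t) :
    FreeAlg.mk s = FreeAlg.mk t := Quotient.sound h

theorem FreeAlg.mk_out {X : Type u} (a : T.FreeAlg X) : FreeAlg.mk (Quotient.out a) = a :=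
  Quotient.out_eq a

theorem FreeAlg.exact {X : Type u} {s t : T.sig.Term X} (h : FreeAlg.mk s = FreeAlg.mk t) :
    T.Provable X s t := Quotient.exact h

/-- The operations act on classes of terms: `o ([t₁], …, [tₙ]) = [o (t₁, …, tₙ)]`
(see `FreeAlg.funMap_mk`). -/
noncomputable instance (X : Type u) : T.sig.Structure (T.FreeAlg X) where
  funMap o ts := FreeAlg.mk (.func o fun i => Quotient.out (ts i))

theorem FreeAlg.funMap_mk {X : Type u} {n : ℕ} (o : T.sig.Functions n)
    (ts : Fin n → T.sig.Term X) :
    FirstOrder.Language.Structure.funMap o (fun i => FreeAlg.mk (ts i)) = FreeAlg.mk (.func o ts) :=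
  FreeAlg.sound (.congr o fun i => FreeAlg.exact (FreeAlg.mk_out (FreeAlg.mk (ts i))))

theorem FreeAlg.realize_mk {X : Type u} {Y : Type*} (σ : Y → T.sig.Term X) (t : T.sig.Term Y) :
    t.realize (fun y => FreeAlg.mk (σ y)) = FreeAlg.mk (t.subst σ) := by
  induction t with
  | var y => rfl
  | func o ts ih =>
    simp only [FirstOrder.Language.Term.realize_func, ih, FirstOrder.Language.Term.subst]
    exact FreeAlg.funMap_mk o _

theorem FreeAlg.satisfies (X : Type u) : T.Satisfies (T.FreeAlg X) := by
  intro e he v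
  have hv : v = fun n => FreeAlg.mk (Quotient.out (v n)) := by
    funext n; exact (FreeAlg.mk_out _).symm
  rw [hv, FreeAlg.realize_mk, FreeAlg.realize_mk]
  exact FreeAlg.sound (.ax he _)

theorem Provable.realize_eq {X A : Type u} [T.sig.Structure A] (hA : T.Satisfies A) (v : X → A)
    {s t : T.sig.Term X} (h : T.Provable X s t) : s.realize v = t.realize v := by
  induction h with
  | refl => rfl
  | symm _ ih => exact ih.symm
  | trans _ _ ih₁ ih₂ => exact ih₁.trans ih₂
  | congr o _ ih => simp only [FirstOrder.Language.Term.realize_func, ih]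
  | ax he σ => simpa only [FirstOrder.Language.Term.realize_subst] using hA _ he _

/-- Evaluation of classes of terms in an algebra, given values of the variables. -/
def FreeAlg.eval {X A : Type u} [T.sig.Structure A] (hA : T.Satisfies A) (v : X → A) :
    T.FreeAlg X → A :=
  Quotient.lift (fun t => t.realize v) fun _ _ h => Provable.realize_eq hA v h

theorem FreeAlg.eval_mk {X A : Type u} [T.sig.Structure A] (hA : T.Satisfies A) (v : X → A)
    (t : T.sig.Term X) : FreeAlg.eval hA v (FreeAlg.mk t) = t.realize v := rfl

theorem Provable.relabel {X Y : Type u} (f : X → Y) {s t : T.sig.Term X} (h : T.Provable X s t) :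
    T.Provable Y (s.relabel f) (t.relabel f) := by
  have key : ∀ r : T.sig.Term X,
      r.realize (fun x => (FreeAlg.mk (.var (f x)) : T.FreeAlg Y)) = FreeAlg.mk (r.relabel f) := by
    intro r
    induction r with
    | var x => rfl
    | func o ts ih =>
      simp only [FirstOrder.Language.Term.realize_func, ih, FirstOrder.Language.Term.relabel]
      exact FreeAlg.funMap_mk o _
  have := h.realize_eq (FreeAlg.satisfies Y) (fun x => (FreeAlg.mk (.var (f x)) : T.FreeAlg Y))
  rw [key, key] at this
  exact FreeAlg.exact this

/-- Renaming of variables. -/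
def FreeAlg.map {X Y : Type u} (f : X → Y) : T.FreeAlg X → T.FreeAlg Y :=
  Quotient.map (fun t => t.relabel f) fun _ _ h => Provable.relabel f h

theorem FreeAlg.map_mk {X Y : Type u} (f : X → Y) (t : T.sig.Term X) :
    FreeAlg.map f (FreeAlg.mk t) = FreeAlg.mk (t.relabel f) := rfl

/-- A term whose variables are (classes of) terms is evaluated to the class of a term:
`t ↦ t` on variables, `o (t₁, …, tₙ) ↦ o (join t₁, …, join tₙ)`. -/
noncomputable def FreeAlg.join {X : Type u} : T.FreeAlg (T.FreeAlg X) → T.FreeAlg X :=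
  FreeAlg.eval (FreeAlg.satisfies X) id

theorem FreeAlg.join_mk {X : Type u} (t : T.sig.Term (T.FreeAlg X)) :
    FreeAlg.join (FreeAlg.mk t) = t.realize id := rfl

theorem FreeAlg.ind {X : Type u} {p : T.FreeAlg X → Prop}
    (var : ∀ x, p (.mk (.var x)))
    (func : ∀ (n : ℕ) (o : T.sig.Functions n) (ts : Fin n → T.FreeAlg X), (∀ i, p (ts i)) →
      p (FirstOrder.Language.Structure.funMap o ts)) (a : T.FreeAlg X) : p a := by
  induction a using Quotient.inductionOn with
  | _ t =>
    change p (.mk t)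
    induction t with
    | var x => exact var x
    | func o ts ih =>
      rw [← FreeAlg.funMap_mk]
      exact func _ o _ ih

theorem FreeAlg.eval_funMap {X A : Type u} [T.sig.Structure A] (hA : T.Satisfies A) (v : X → A)
    {n : ℕ} (o : T.sig.Functions n) (ts : Fin n → T.FreeAlg X) :
    FreeAlg.eval hA v (FirstOrder.Language.Structure.funMap o ts) =
      FirstOrder.Language.Structure.funMap o fun i => FreeAlg.eval hA v (ts i) := by
  obtain ⟨t, rfl⟩ : ∃ t : Fin n → T.sig.Term X, ts = fun i => FreeAlg.mk (t i) :=
    ⟨fun i => Quotient.out (ts i), by funext i; exact (FreeAlg.mk_out _).symm⟩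
  rw [FreeAlg.funMap_mk]; rfl

theorem FreeAlg.join_funMap {X : Type u} {n : ℕ} (o : T.sig.Functions n)
    (ts : Fin n → T.FreeAlg (T.FreeAlg X)) :
    FreeAlg.join (FirstOrder.Language.Structure.funMap o ts) =
      FirstOrder.Language.Structure.funMap o fun i => FreeAlg.join (ts i) :=
  FreeAlg.eval_funMap _ _ o ts

theorem FreeAlg.map_funMap {X Y : Type u} (f : X → Y) {n : ℕ} (o : T.sig.Functions n)
    (ts : Fin n → T.FreeAlg X) :
    FreeAlg.map f (FirstOrder.Language.Structure.funMap o ts) =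
      FirstOrder.Language.Structure.funMap o fun i => FreeAlg.map f (ts i) := by
  obtain ⟨t, rfl⟩ : ∃ t : Fin n → T.sig.Term X, ts = fun i => FreeAlg.mk (t i) :=
    ⟨fun i => Quotient.out (ts i), by funext i; exact (FreeAlg.mk_out _).symm⟩
  simp only [FreeAlg.funMap_mk, FreeAlg.map_mk, FirstOrder.Language.Term.relabel]

theorem FreeAlg.join_map_join {X : Type u} (a : T.FreeAlg (T.FreeAlg (T.FreeAlg X))) :
    FreeAlg.join (FreeAlg.map FreeAlg.join a) = FreeAlg.join (FreeAlg.join a) := by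
  induction a using FreeAlg.ind with
  | var x => rfl
  | func n o ts ih => simp only [FreeAlg.map_funMap, FreeAlg.join_funMap, ih]

variable (T)

/-- The term monad of a theory. -/
noncomputable def termMonad : CategoryTheory.Monad (Type u) where
  obj X := T.FreeAlg X
  map f := ↾(FreeAlg.map f)
  map_id X := by
    ext a
    induction a using Quotient.inductionOn with
    | _ t => exact congrArg FreeAlg.mk (FirstOrder.Language.Term.relabel_id t)
  map_comp f g := by
    ext a
    induction a using Quotient.inductionOn with
    | _ t => exact (congrArg FreeAlg.mk (FirstOrder.Language.Term.relabel_relabel f g t)).symm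
  η := { app := fun X => ↾(fun x : X => FreeAlg.mk (.var x)) }
  μ :=
    { app := fun X => ↾(FreeAlg.join (X := X))
      naturality := by
        intro X Y f
        ext a
        change FreeAlg.join (FreeAlg.map (FreeAlg.map f) a) = FreeAlg.map f (FreeAlg.join a)
        induction a using FreeAlg.ind with
        | var x => rfl
        | func n o ts ih => simp only [FreeAlg.map_funMap, FreeAlg.join_funMap, ih] }
  assoc X := by
    ext a
    change FreeAlg.join (FreeAlg.map FreeAlg.join a) = FreeAlg.join (FreeAlg.join a)
    exact FreeAlg.join_map_join a
  left_unit X := by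
    ext a
    rfl
  right_unit X := by
    ext a
    change FreeAlg.join (FreeAlg.map (fun x : X => FreeAlg.mk (.var x)) a) = a
    induction a using FreeAlg.ind with
    | var x => rfl
    | func n o ts ih => simp only [FreeAlg.map_funMap, FreeAlg.join_funMap, ih]

/-- The theory `T` presents the monad `M`: the category of Eilenberg-Moore algebras of `M` and the
category of algebras of `T` are isomorphic, by an isomorphism that commutes with the forgetful
functors to sets. -/
def Presents (M : CategoryTheory.Monad (Type u)) : Prop :=
  ∃ (F : M.Algebra ⥤ T.Alg) (G : T.Alg ⥤ M.Algebra),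
    F ⋙ G = 𝟭 M.Algebra ∧ G ⋙ F = 𝟭 T.Alg ∧ F ⋙ T.forgetAlg = M.forget

end AlgTheory

/-! ## The theory of semilattices, `S`-semimodules and distributivity -/

/-- The operation symbols, by arity: `⊥` and `⊔` of semilattices, and `0`, `+` and
`lam · _` (for `lam` in `S`) of `S`-semimodules. -/
inductive ConvexOp (S : Type u) : ℕ → Type u
  | bot : ConvexOp S 0
  | sup : ConvexOp S 2
  | zero : ConvexOp S 0
  | add : ConvexOp S 2
  | smul (lam : S) : ConvexOp S 1

/-- The signature `Σ'`. -/
def convexSig (S : Type u) : FirstOrder.Language.{u, 0} := ⟨ConvexOp S, fun _ => Empty⟩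

namespace ConvexTerm

variable {S : Type u} {α : Type*}

/-- The term `⊥`. -/
def bot : (convexSig S).Term α :=
  FirstOrder.Language.Constants.term (L := convexSig S) (ConvexOp.bot : ConvexOp S 0)

/-- The term `s ⊔ t`. -/
def sup (s t : (convexSig S).Term α) : (convexSig S).Term α :=
  FirstOrder.Language.Functions.apply₂ (L := convexSig S) (ConvexOp.sup : ConvexOp S 2) s t

/-- The term `0`. -/
def zero : (convexSig S).Term α :=
  FirstOrder.Language.Constants.term (L := convexSig S) (ConvexOp.zero : ConvexOp S 0)

/-- The term `s + t`. -/
def add (s t : (convexSig S).Term α) : (convexSig S).Term α :=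
  FirstOrder.Language.Functions.apply₂ (L := convexSig S) (ConvexOp.add : ConvexOp S 2) s t

/-- The term `lam · t`. -/
def smul (lam : S) (t : (convexSig S).Term α) : (convexSig S).Term α :=
  FirstOrder.Language.Functions.apply₁ (L := convexSig S) (ConvexOp.smul lam : ConvexOp S 1) t

/-- The variable `x`. -/
def x : (convexSig S).Term ℕ := .var 0
/-- The variable `y`. -/
def y : (convexSig S).Term ℕ := .var 1
/-- The variable `z`. -/
def z : (convexSig S).Term ℕ := .var 2

end ConvexTerm

open ConvexTerm in
/-- The axioms for semilattices. -/
inductive SemilatticeAx (S : Type u) : (convexSig S).Term ℕ → (convexSig S).Term ℕ → Prop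
  | assoc : SemilatticeAx S (sup (sup x y) z) (sup x (sup y z))
  | comm : SemilatticeAx S (sup x y) (sup y x)
  | unit : SemilatticeAx S (sup x bot) x
  | idem : SemilatticeAx S (sup x x) x

open ConvexTerm in
/-- The axioms for left `S`-semimodules. -/
inductive SemimoduleAx (S : Type u) [Semiring S] :
    (convexSig S).Term ℕ → (convexSig S).Term ℕ → Prop
  | add_assoc : SemimoduleAx S (add (add x y) z) (add x (add y z))
  | add_comm : SemimoduleAx S (add x y) (add y x)
  | add_zero : SemimoduleAx S (add x zero) x
  | smul_zero (lam : S) : SemimoduleAx S (smul lam zero) zero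
  | zero_smul : SemimoduleAx S (smul 0 x) zero
  | one_smul : SemimoduleAx S (smul 1 x) x
  | mul_smul (lam mu : S) : SemimoduleAx S (smul (lam * mu) x) (smul lam (smul mu x))
  | smul_add (lam : S) : SemimoduleAx S (smul lam (add x y)) (add (smul lam x) (smul lam y))
  | add_smul (lam mu : S) : SemimoduleAx S (smul (lam + mu) x) (add (smul lam x) (smul mu x))

open ConvexTerm in
/-- The four distributivity axioms. -/
inductive DistribAx (S : Type u) [Semiring S] :
    (convexSig S).Term ℕ → (convexSig S).Term ℕ → Prop
  | smul_bot (lam : S) (h : lam ≠ 0) : DistribAx S (smul lam bot) bot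
  | add_bot : DistribAx S (add x bot) bot
  | smul_sup (lam : S) : DistribAx S (smul lam (sup x y)) (sup (smul lam x) (smul lam y))
  | add_sup : DistribAx S (add x (sup y z)) (sup (add x y) (add x z))

/-- The theory `(Σ', E')`. -/
def convexTheory (S : Type u) [Semiring S] : AlgTheory.{u} where
  sig := convexSig S
  algebraic _ := inferInstanceAs (IsEmpty Empty)
  eqs := {e | SemilatticeAx S e.1 e.2 ∨ SemimoduleAx S e.1 e.2 ∨ DistribAx S e.1 e.2}

/-! ## Convex subsets of semimodules -/

/-- A positive semifield: a (not necessarily commutative) semiring in which `a + b = 0` implies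
`a = 0 = b`, and in which every nonzero element has a two-sided multiplicative inverse. -/
class PositiveSemifield (S : Type u) [Semiring S] : Prop where
  positive : ∀ a b : S, a + b = 0 → a = 0 ∧ b = 0
  exists_inv : ∀ a : S, a ≠ 0 → ∃ b : S, a * b = 1 ∧ b * a = 1

section Convex

variable (S : Type u) [Semiring S]

/-- The structure map `∑ m, φ m • m` of a semimodule `M`. For `M = X →₀ S` this is the
multiplication of the monad of `S`-semimodules. -/
noncomputable def linComb {M : Type*} [AddCommMonoid M] [Module S M] (φ : M →₀ S) : M :=
  φ.sum fun m r => r • m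

/-- The convex closure of a subset of a semimodule. -/
def convexClosure {M : Type*} [AddCommMonoid M] [Module S M] (A : Set M) : Set M :=
  {m | ∃ φ : M →₀ S, (φ.support : Set M) ⊆ A ∧ (φ.sum fun _ r => r) = 1 ∧ linComb S φ = m}

/-- A subset of a semimodule is convex. -/
def IsConvex {M : Type*} [AddCommMonoid M] [Module S M] (A : Set M) : Prop :=
  convexClosure S A = A

/-- The finitely generated convex subsets of the free semimodule on `X`. -/
@[ext]
structure FGConvex (X : Type u) : Type u where
  carrier : Set (X →₀ S)
  convex : IsConvex S carrier
  fg : ∃ B : Set (X →₀ S), B.Finite ∧ convexClosure S B = carrier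

/-- For a finitely supported `Φ` on a family of subsets `c p ⊆ M`: the images of `Φ` under the
functions that choose an element of `c p` for every `p` in the support of `Φ`. -/
def choiceSet {P M : Type*} [AddCommMonoid M] (c : P → Set M) (Φ : P →₀ S) : Set (M →₀ S) :=
  {φ | ∃ w : P → M, (∀ p ∈ Φ.support, w p ∈ c p) ∧ φ = Φ.mapDomain w}

/-- The semimodule structure map on subsets. -/
def alphaSet {P M : Type*} [AddCommMonoid M] [Module S M] (c : P → Set M) (Φ : P →₀ S) : Set M :=
  linComb S '' choiceSet S c Φ

/-- The union of the sets `alphaSet Ω`, for `Ω` in a family of formal combinations of finitely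
generated convex sets. -/
def joinSet {X : Type u} (A : Set (FGConvex S X →₀ S)) : Set (X →₀ S) :=
  ⋃ Ω ∈ A, alphaSet S FGConvex.carrier Ω

end Convex

namespace ConvexAux

variable {S : Type u} [Semiring S]
variable {M : Type*} [AddCommMonoid M] [Module S M]

open Finset

theorem linComb_sum_single {ι : Type*} (s : Finset ι) (r : ι → S) (a : ι → M) :
    linComb S (∑ i ∈ s, Finsupp.single (a i) (r i)) = ∑ i ∈ s, r i • a i := by
  classical
  unfold linComb
  rw [← Finsupp.sum_finsetSum_index (by simp) (by intros; rw [add_smul])]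
  exact Finset.sum_congr rfl fun i _ => by simp

theorem sum_mem_closure {A : Set M} {ι : Type*} (s : Finset ι) (r : ι → S) (a : ι → M)
    (h1 : ∑ i ∈ s, r i = 1) (ha : ∀ i ∈ s, r i ≠ 0 → a i ∈ A) :
    ∑ i ∈ s, r i • a i ∈ convexClosure S A := by
  classical
  have e1 : ∑ i ∈ s with r i ≠ 0, r i = ∑ i ∈ s, r i := Finset.sum_filter_ne_zero s
  have e2 : ∑ i ∈ s with r i ≠ 0, r i • a i = ∑ i ∈ s, r i • a i := by
    refine Finset.sum_filter_of_ne fun i _ h h0 => h ?_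
    rw [h0, zero_smul]
  refine ⟨∑ i ∈ s with r i ≠ 0, Finsupp.single (a i) (r i), ?_, ?_, ?_⟩
  · intro m hm
    have := Finsupp.support_finsetSum hm
    simp only [Finset.mem_biUnion, Finset.mem_filter] at this
    obtain ⟨i, ⟨hi, h0⟩, hm⟩ := this
    have := Finsupp.support_single_subset hm
    rw [Finset.mem_singleton] at this
    exact this ▸ ha i hi h0
  · rw [← Finsupp.sum_finsetSum_index (by simp) (by simp), ← h1, ← e1]
    exact Finset.sum_congr rfl fun i _ => by simp
  · rw [linComb_sum_single, e2]

theorem sum_mem {A : Set M} (hA : IsConvex S A) {ι : Type*} (s : Finset ι) (r : ι → S)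
    (a : ι → M) (h1 : ∑ i ∈ s, r i = 1) (ha : ∀ i ∈ s, r i ≠ 0 → a i ∈ A) :
    ∑ i ∈ s, r i • a i ∈ A := by
  have := sum_mem_closure s r a h1 ha
  rwa [hA] at this

theorem subset_closure (A : Set M) : A ⊆ convexClosure S A := by
  intro a ha
  simpa using sum_mem_closure (S := S) (A := A) {()} (fun _ => 1) (fun _ => a) (by simp)
    (fun _ _ _ => ha)

theorem isConvex_of {A : Set M} (h : ∀ φ : M →₀ S, (φ.support : Set M) ⊆ A →
    ∑ m ∈ φ.support, φ m = 1 → ∑ m ∈ φ.support, φ m • m ∈ A) : IsConvex S A := by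
  refine Set.Subset.antisymm ?_ (subset_closure A)
  rintro m ⟨φ, h1, h2, rfl⟩
  exact h φ h1 h2

theorem closure_mono {A B : Set M} (h : A ⊆ B) : convexClosure S A ⊆ convexClosure S B := by
  rintro m ⟨φ, h1, h2, h3⟩
  exact ⟨φ, h1.trans h, h2, h3⟩

theorem closure_subset {A B : Set M} (hB : IsConvex S B) (h : A ⊆ B) : convexClosure S A ⊆ B :=
  hB ▸ closure_mono h

theorem isConvex_closure (A : Set M) : IsConvex S (convexClosure S A) := by
  classical
  refine isConvex_of fun φ hφ h1 => ?_
  have : ∀ m : M, ∃ ψ : M →₀ S, m ∈ φ.support →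
      (ψ.support : Set M) ⊆ A ∧ ∑ a ∈ ψ.support, ψ a = 1 ∧ ∑ a ∈ ψ.support, ψ a • a = m := by
    intro m
    by_cases hm : m ∈ φ.support
    · obtain ⟨ψ, hψ⟩ := hφ hm
      exact ⟨ψ, fun _ => hψ⟩
    · exact ⟨0, fun h => absurd h hm⟩
  choose ψ hψ using this
  have key := sum_mem_closure (S := S) (A := A) (φ.support.sigma fun m => (ψ m).support)
    (fun p => φ p.1 * ψ p.1 p.2) (fun p => p.2) ?_ ?_
  · rw [Finset.sum_sigma] at key
    convert key using 1
    refine Finset.sum_congr rfl fun m hm => ?_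
    calc φ m • m = φ m • ∑ a ∈ (ψ m).support, ψ m a • a := by rw [(hψ m hm).2.2]
      _ = _ := by
        rw [Finset.smul_sum]
        exact Finset.sum_congr rfl fun a _ => by rw [mul_smul]
  · rw [Finset.sum_sigma, ← h1]
    refine Finset.sum_congr rfl fun m hm => ?_
    change ∑ a ∈ (ψ m).support, φ m * ψ m a = φ m
    rw [← Finset.mul_sum, (hψ m hm).2.1, mul_one]
  · rintro ⟨m, a⟩ h _
    rw [Finset.mem_sigma] at h
    exact (hψ m h.1).1 h.2

theorem closure_singleton (m : M) : convexClosure S {m} = {m} := by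
  refine isConvex_of fun φ hφ h1 => ?_
  have : ∑ a ∈ φ.support, φ a • a = ∑ a ∈ φ.support, φ a • m :=
    Finset.sum_congr rfl fun a ha => by rw [show a = m from hφ ha]
  rw [Set.mem_singleton_iff, this, ← Finset.sum_smul, h1, one_smul]

theorem closure_image {N : Type*} [AddCommMonoid N] [Module S N] (f : M →ₗ[S] N) (A : Set M) :
    convexClosure S (f '' A) = f '' convexClosure S A := by
  refine Set.Subset.antisymm (closure_subset (isConvex_of fun φ hφ h1 => ?_)
    (Set.image_mono (subset_closure A))) ?_
  · have : ∀ n : N, ∃ m : M, n ∈ φ.support → m ∈ convexClosure S A ∧ f m = n := by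
      intro n
      by_cases hn : n ∈ φ.support
      · obtain ⟨m, hm⟩ := hφ hn
        exact ⟨m, fun _ => hm⟩
      · exact ⟨0, fun h => absurd h hn⟩
    choose g hg using this
    refine ⟨∑ n ∈ φ.support, φ n • g n,
      sum_mem (isConvex_closure A) _ _ _ h1 fun n hn _ => (hg n hn).1, ?_⟩
    rw [map_sum]
    exact Finset.sum_congr rfl fun n hn => by rw [map_smul, (hg n hn).2]
  · rintro _ ⟨_, ⟨φ, h1, h2, rfl⟩, rfl⟩
    change f (∑ m ∈ φ.support, φ m • m) ∈ _
    rw [map_sum]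
    simp only [map_smul]
    exact sum_mem_closure _ _ _ h2 fun m hm _ => ⟨m, h1 hm, rfl⟩

theorem add_closure (A B : Set M) :
    convexClosure S (Set.image2 (· + ·) A B) =
      Set.image2 (· + ·) (convexClosure S A) (convexClosure S B) := by
  refine Set.Subset.antisymm (closure_subset (isConvex_of fun φ hφ hs => ?_)
    (Set.image2_subset (subset_closure A) (subset_closure B))) ?_
  · have : ∀ n : M, ∃ p : M × M, n ∈ φ.support →
        p.1 ∈ convexClosure S A ∧ p.2 ∈ convexClosure S B ∧ p.1 + p.2 = n := by
      intro n
      by_cases hn : n ∈ φ.support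
      · obtain ⟨a, ha, b, hb, e⟩ := hφ hn
        exact ⟨(a, b), fun _ => ⟨ha, hb, e⟩⟩
      · exact ⟨0, fun h => absurd h hn⟩
    choose p hp using this
    refine ⟨_, sum_mem (isConvex_closure A) φ.support φ (fun n => (p n).1) hs
      fun n hn _ => (hp n hn).1, _, sum_mem (isConvex_closure B) φ.support φ (fun n => (p n).2) hs
      fun n hn _ => (hp n hn).2.1, ?_⟩
    change _ + _ = _
    rw [← Finset.sum_add_distrib]
    refine Finset.sum_congr rfl fun n hn => ?_
    rw [← smul_add, (hp n hn).2.2]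
  · have shift : ∀ (φ : M →₀ S) (b : M), (φ.sum fun _ r => r) = 1 →
        linComb S φ + b = ∑ a ∈ φ.support, φ a • (a + b) := by
      intro φ b hs
      simp only [smul_add, Finset.sum_add_distrib, ← Finset.sum_smul]
      rw [show ∑ a ∈ φ.support, φ a = 1 from hs, one_smul]
      rfl
    rintro _ ⟨_, ⟨φ, ha, hs, rfl⟩, b, hb, rfl⟩
    change linComb S φ + b ∈ _
    rw [shift φ b hs]
    refine sum_mem (isConvex_closure _) _ _ _ hs fun a haφ _ => ?_
    obtain ⟨ψ, hbψ, hsψ, rfl⟩ := hb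
    rw [add_comm, shift ψ a hsψ]
    refine sum_mem_closure _ _ _ hsψ fun b hbb _ => ⟨a, ha haφ, b, hbψ hbb, add_comm _ _⟩

theorem mem_alpha {P : Type*} {c : P → Set M} {Φ : P →₀ S} {m : M} :
    m ∈ alphaSet S c Φ ↔
      ∃ w : P → M, (∀ p ∈ Φ.support, w p ∈ c p) ∧ m = ∑ p ∈ Φ.support, Φ p • w p := by
  have e : ∀ w : P → M, linComb S (Φ.mapDomain w) = ∑ p ∈ Φ.support, Φ p • w p := fun w =>
    linComb_sum_single _ _ _
  constructor
  · rintro ⟨_, ⟨w, hw, rfl⟩, rfl⟩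
    exact ⟨w, hw, e w⟩
  · rintro ⟨w, hw, rfl⟩
    exact ⟨_, ⟨w, hw, rfl⟩, e w⟩

theorem sum_single_apply {P ι : Type*} [DecidableEq P] (s : Finset ι) (r : ι → S) (C : ι → P)
    (p : P) : (∑ i ∈ s, Finsupp.single (C i) (r i)) p = ∑ i ∈ s with C i = p, r i := by
  rw [Finsupp.finsetSum_apply, Finset.sum_filter]
  simp only [Finsupp.single_apply]

theorem sum_smul_eq {P ι : Type*} (s : Finset ι) (l : ι → S) (Ω : ι → P →₀ S) :
    ∑ i ∈ s, l i • Ω i = ∑ q ∈ s.sigma fun i => (Ω i).support,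
      Finsupp.single q.2 (l q.1 * Ω q.1 q.2) := by
  rw [Finset.sum_sigma]
  refine Finset.sum_congr rfl fun i _ => ?_
  conv_lhs => rw [← Finsupp.sum_single (Ω i)]
  rw [Finsupp.sum, Finset.smul_sum]
  exact Finset.sum_congr rfl fun p _ => by rw [Finsupp.smul_single, smul_eq_mul]

section Positive

variable [PositiveSemifield S]

theorem sum_eq_zero {ι : Type*} {s : Finset ι} {r : ι → S} (h : ∑ i ∈ s, r i = 0) :
    ∀ i ∈ s, r i = 0 := by
  classical
  induction s using Finset.induction_on with
  | empty => simp
  | insert j s hj ih =>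
    rw [Finset.sum_insert hj] at h
    obtain ⟨h1, h2⟩ := PositiveSemifield.positive _ _ h
    intro i hi
    rcases Finset.mem_insert.1 hi with rfl | hi
    · exact h1
    · exact ih h2 i hi

theorem mul_ne_zero' {a b : S} (ha : a ≠ 0) (hb : b ≠ 0) : a * b ≠ 0 := by
  obtain ⟨a', _, h⟩ := PositiveSemifield.exists_inv a ha
  intro h0
  apply hb
  rw [← one_mul b, ← h, mul_assoc, h0, mul_zero]

theorem exists_smul {A : Set M} (hA : IsConvex S A) {ι : Type*} (s : Finset ι) (r : ι → S)
    (a : ι → M) (h0 : ∑ i ∈ s, r i ≠ 0) (ha : ∀ i ∈ s, r i ≠ 0 → a i ∈ A) :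
    ∃ m ∈ A, ∑ i ∈ s, r i • a i = (∑ i ∈ s, r i) • m := by
  obtain ⟨t, h1, h2⟩ := PositiveSemifield.exists_inv _ h0
  refine ⟨∑ i ∈ s, (t * r i) • a i, sum_mem hA _ _ _ ?_ ?_, ?_⟩
  · rw [← Finset.mul_sum, h2]
  · exact fun i hi h => ha i hi fun h' => h (by rw [h', mul_zero])
  · rw [Finset.smul_sum]
    conv_lhs => rw [← one_smul S (∑ i ∈ s, r i • a i), ← h1, mul_smul, Finset.smul_sum,
      Finset.smul_sum]
    simp only [mul_smul]

/-- The elements of `α (∑ i, r i · C i)` are the combinations `∑ i, r i • y i` with `y i ∈ C i`. -/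
theorem mem_alpha_sum {P ι : Type*} {c : P → Set M} (hc : ∀ p, IsConvex S (c p))
    (s : Finset ι) (r : ι → S) (C : ι → P) {m : M} :
    m ∈ alphaSet S c (∑ i ∈ s, Finsupp.single (C i) (r i)) ↔
      ∃ y : ι → M, (∀ i ∈ s, r i ≠ 0 → y i ∈ c (C i)) ∧ m = ∑ i ∈ s, r i • y i := by
  classical
  set Φ := ∑ i ∈ s, Finsupp.single (C i) (r i) with hΦ
  have hsub : Φ.support ⊆ s.image C := by
    intro p hp
    have := Finsupp.support_finsetSum hp
    simp only [Finset.mem_biUnion] at this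
    obtain ⟨i, hi, hp⟩ := this
    rw [Finset.mem_singleton.1 (Finsupp.support_single_subset hp)]
    exact Finset.mem_image_of_mem _ hi
  have hfib : ∀ y : ι → M, ∑ i ∈ s, r i • y i =
      ∑ p ∈ s.image C, ∑ i ∈ s with C i = p, r i • y i := fun y =>
    (Finset.sum_fiberwise_of_maps_to (fun i hi => Finset.mem_image_of_mem C hi) _).symm
  have hext : ∀ w : P → M, ∑ p ∈ Φ.support, Φ p • w p = ∑ p ∈ s.image C, Φ p • w p := fun w =>
    Finset.sum_subset hsub fun p _ hp => by rw [Finsupp.notMem_support_iff.1 hp, zero_smul]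
  rw [mem_alpha]
  constructor
  · rintro ⟨w, hw, rfl⟩
    refine ⟨fun i => w (C i), fun i hi h0 => hw _ ?_, ?_⟩
    · rw [Finsupp.mem_support_iff, hΦ, sum_single_apply]
      exact fun h => h0 (sum_eq_zero h i (by simp [hi]))
    · rw [hext, hfib]
      refine Finset.sum_congr rfl fun p _ => ?_
      rw [hΦ, sum_single_apply, Finset.sum_smul]
      exact Finset.sum_congr rfl fun i hi => by rw [(Finset.mem_filter.1 hi).2]
  · rintro ⟨y, hy, rfl⟩
    have : ∀ p : P, ∃ m : M, (p ∈ Φ.support → m ∈ c p) ∧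
        ∑ i ∈ s with C i = p, r i • y i = Φ p • m := by
      intro p
      by_cases hp : p ∈ Φ.support
      · rw [Finsupp.mem_support_iff] at hp
        have hp' := hp
        rw [hΦ, sum_single_apply] at hp'
        obtain ⟨m, hm, e⟩ := exists_smul (hc p) _ r y hp' fun i hi h0 => by
          rw [Finset.mem_filter] at hi
          exact hi.2 ▸ hy i hi.1 h0
        exact ⟨m, fun _ => hm, by rw [e, hΦ, sum_single_apply]⟩
      · refine ⟨0, fun h => absurd h hp, ?_⟩
        rw [smul_zero]
        have h0 := Finsupp.notMem_support_iff.1 hp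
        rw [hΦ, sum_single_apply] at h0
        exact Finset.sum_eq_zero fun i hi => by rw [sum_eq_zero h0 i hi, zero_smul]
    choose w hw hw' using this
    refine ⟨w, fun p hp => hw p hp, ?_⟩
    rw [hext, hfib]
    exact Finset.sum_congr rfl fun p _ => hw' p

theorem mem_alpha_combo {P ι : Type*} {c : P → Set M} (hc : ∀ p, IsConvex S (c p))
    (s : Finset ι) (l : ι → S) (Ω : ι → P →₀ S) {m : M} :
    m ∈ alphaSet S c (∑ i ∈ s, l i • Ω i) ↔
      ∃ y : ι → M, (∀ i ∈ s, l i ≠ 0 → y i ∈ alphaSet S c (Ω i)) ∧ m = ∑ i ∈ s, l i • y i := by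
  classical
  rw [sum_smul_eq, mem_alpha_sum hc]
  constructor
  · rintro ⟨y, hy, rfl⟩
    refine ⟨fun i => ∑ p ∈ (Ω i).support, Ω i p • y ⟨i, p⟩, fun i hi h0 => ?_, ?_⟩
    · refine mem_alpha.2 ⟨fun p => y ⟨i, p⟩, fun p hp => ?_, rfl⟩
      exact hy ⟨i, p⟩ (Finset.mem_sigma.2 ⟨hi, hp⟩)
        (mul_ne_zero' h0 (Finsupp.mem_support_iff.1 hp))
    · rw [Finset.sum_sigma]
      simp only [Finset.smul_sum, mul_smul]
  · rintro ⟨y, hy, rfl⟩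
    have : ∀ i : ι, ∃ w : P → M, i ∈ s → l i ≠ 0 →
        (∀ p ∈ (Ω i).support, w p ∈ c p) ∧ y i = ∑ p ∈ (Ω i).support, Ω i p • w p := by
      intro i
      by_cases h : i ∈ s ∧ l i ≠ 0
      · obtain ⟨w, hw⟩ := mem_alpha.1 (hy i h.1 h.2)
        exact ⟨w, fun _ _ => hw⟩
      · exact ⟨0, fun h1 h2 => absurd ⟨h1, h2⟩ h⟩
    choose w hw using this
    refine ⟨fun q => w q.1 q.2, ?_, ?_⟩
    · rintro ⟨i, p⟩ hq h0
      rw [Finset.mem_sigma] at hq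
      exact (hw i hq.1 fun h => h0 (by simp [h])).1 p hq.2
    · rw [Finset.sum_sigma]
      refine Finset.sum_congr rfl fun i hi => ?_
      by_cases h0 : l i = 0
      · simp [h0]
      · rw [(hw i hi h0).2, Finset.smul_sum]
        simp only [mul_smul]

theorem smul_closure {r : S} (hr : r ≠ 0) (A : Set M) :
    convexClosure S ((fun m => r • m) '' A) = (fun m => r • m) '' convexClosure S A := by
  obtain ⟨t, h1, h2⟩ := PositiveSemifield.exists_inv r hr
  refine Set.Subset.antisymm (closure_subset (isConvex_of fun φ hφ hs => ?_)
    (Set.image_mono (subset_closure A))) ?_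
  · have hmem : ∀ n ∈ φ.support, t • n ∈ convexClosure S A := by
      intro n hn
      obtain ⟨m, hm, rfl⟩ := hφ hn
      simpa only [smul_smul, h2, one_smul] using hm
    refine ⟨∑ n ∈ φ.support, (t * φ n * r) • (t • n), sum_mem (isConvex_closure A) _ _ _ ?_
      fun n hn _ => hmem n hn, ?_⟩
    · rw [← Finset.sum_mul, ← Finset.mul_sum, hs, mul_one, h2]
    · simp only [Finset.smul_sum, smul_smul]
      refine Finset.sum_congr rfl fun n _ => ?_
      congr 1
      calc r * (t * φ n * r * t) = (r * t) * φ n * (r * t) := by simp only [mul_assoc]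
        _ = φ n := by rw [h1, one_mul, mul_one]
  · rintro _ ⟨_, ⟨φ, ha, hs, rfl⟩, rfl⟩
    change r • ∑ m ∈ φ.support, φ m • m ∈ _
    have : r • ∑ m ∈ φ.support, φ m • m = ∑ m ∈ φ.support, (r * φ m * t) • (r • m) := by
      rw [Finset.smul_sum]
      refine Finset.sum_congr rfl fun m _ => ?_
      rw [smul_smul, smul_smul, mul_assoc (r * φ m), h2, mul_one]
    rw [this]
    refine sum_mem_closure _ _ _ ?_ fun m hm _ => ⟨m, ha hm, rfl⟩
    rw [← Finset.sum_mul, ← Finset.mul_sum]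
    change r * (φ.sum fun _ r => r) * t = 1
    rw [hs, mul_one, h1]

theorem alpha_fg {P : Type*} {c : P → Set M}
    (hfg : ∀ p, ∃ B : Set M, B.Finite ∧ convexClosure S B = c p) (Φ : P →₀ S) :
    ∃ B : Set M, B.Finite ∧ convexClosure S B = alphaSet S c Φ := by
  classical
  have main : ∀ s : Finset P, (∀ p ∈ s, Φ p ≠ 0) → ∃ B : Set M, B.Finite ∧ convexClosure S B =
      {m | ∃ w : P → M, (∀ p ∈ s, w p ∈ c p) ∧ m = ∑ p ∈ s, Φ p • w p} := by
    intro s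
    induction s using Finset.induction_on with
    | empty =>
      intro _
      exact ⟨{0}, Set.finite_singleton _, by rw [closure_singleton]; ext m; simp⟩
    | insert q s hq ih =>
      intro h0
      obtain ⟨B, hB, e⟩ := ih fun p hp => h0 p (Finset.mem_insert_of_mem hp)
      obtain ⟨D, hD, e'⟩ := hfg q
      refine ⟨_, (hD.image fun m => Φ q • m).image2 (· + ·) hB, ?_⟩
      rw [add_closure, smul_closure (h0 q (Finset.mem_insert_self _ _)), e, e']
      ext m
      constructor
      · rintro ⟨_, ⟨a, ha, rfl⟩, _, ⟨w, hw, rfl⟩, rfl⟩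
        have hne : ∀ p ∈ s, p ≠ q := fun p hp h => hq (h ▸ hp)
        refine ⟨Function.update w q a, fun p hp => ?_, ?_⟩
        · rcases Finset.mem_insert.1 hp with rfl | hp
          · simpa using ha
          · rw [Function.update_of_ne (hne p hp)]
            exact hw p hp
        · rw [Finset.sum_insert hq, Function.update_self]
          refine congrArg _ (Finset.sum_congr rfl fun p hp => ?_)
          rw [Function.update_of_ne (hne p hp)]
      · rintro ⟨w, hw, rfl⟩
        refine ⟨_, ⟨w q, hw q (Finset.mem_insert_self _ _), rfl⟩, _,
          ⟨w, fun p hp => hw p (Finset.mem_insert_of_mem hp), rfl⟩, ?_⟩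
        rw [Finset.sum_insert hq]
  obtain ⟨B, hB, e⟩ := main Φ.support fun p hp => Finsupp.mem_support_iff.1 hp
  refine ⟨B, hB, ?_⟩
  rw [e]
  ext m
  exact mem_alpha.symm

end Positive

end ConvexAux

/-! ## The monad of finitely generated convex subsets -/

namespace FGConvex

open ConvexAux

variable {S : Type u} [Semiring S]

/-- The image of a finitely generated convex set under the linear map induced by a function. -/
noncomputable def map {X Y : Type u} (f : X → Y) (A : FGConvex S X) : FGConvex S Y where
  carrier := Finsupp.mapDomain f '' A.carrier
  convex := by
    have := closure_image (S := S) (Finsupp.lmapDomain S S f) A.carrier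
    rwa [A.convex] at this
  fg := by
    obtain ⟨B, hB, e⟩ := A.fg
    have := closure_image (S := S) (Finsupp.lmapDomain S S f) B
    rw [e] at this
    exact ⟨_, hB.image _, this⟩

/-- The singleton of the Dirac function at `x`. -/
noncomputable def pure {X : Type u} (x : X) : FGConvex S X where
  carrier := {Finsupp.single x 1}
  convex := closure_singleton _
  fg := ⟨_, Set.finite_singleton _, closure_singleton _⟩

variable [PositiveSemifield S]

theorem joinSet_convex {X : Type u} {A : Set (FGConvex S X →₀ S)} (hA : IsConvex S A) :
    IsConvex S (joinSet S A) := by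
  refine isConvex_of fun φ hφ h1 => ?_
  have : ∀ m : X →₀ S, ∃ Ω : FGConvex S X →₀ S,
      m ∈ φ.support → Ω ∈ A ∧ m ∈ alphaSet S carrier Ω := by
    intro m
    by_cases hm : m ∈ φ.support
    · obtain ⟨Ω, hΩ⟩ := Set.mem_iUnion.1 (hφ hm)
      obtain ⟨h, h'⟩ := Set.mem_iUnion.1 hΩ
      exact ⟨Ω, fun _ => ⟨h, h'⟩⟩
    · exact ⟨0, fun h => absurd h hm⟩
  choose Ω hΩ using this
  refine Set.mem_iUnion₂.2 ⟨∑ m ∈ φ.support, φ m • Ω m,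
    sum_mem hA _ _ _ h1 fun m hm _ => (hΩ m hm).1, ?_⟩
  exact (mem_alpha_combo (fun p => p.convex) _ _ _).2 ⟨id, fun m hm _ => (hΩ m hm).2, rfl⟩

theorem joinSet_fg {X : Type u} {A B : Set (FGConvex S X →₀ S)} (hA : IsConvex S A)
    (hB : B.Finite) (e : convexClosure S B = A) :
    ∃ D : Set (X →₀ S), D.Finite ∧ convexClosure S D = joinSet S A := by
  choose D hD hD' using fun Ω : FGConvex S X →₀ S =>
    alpha_fg (c := FGConvex.carrier (S := S) (X := X)) (fun p => p.fg) Ω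
  have hDA : ∀ Ω ∈ B, convexClosure S (D Ω) ⊆ convexClosure S (⋃ Ω ∈ B, D Ω) := fun Ω hΩ =>
    closure_mono (Set.subset_biUnion_of_mem (u := D) hΩ)
  refine ⟨⋃ Ω ∈ B, D Ω, hB.biUnion fun Ω _ => hD Ω, Set.Subset.antisymm ?_ ?_⟩
  · refine closure_subset (joinSet_convex hA) (Set.iUnion₂_subset fun Ω hΩ => ?_)
    refine Set.Subset.trans (subset_closure (S := S) _) ?_
    rw [hD']
    exact Set.subset_biUnion_of_mem (u := alphaSet S carrier) (e ▸ subset_closure (S := S) B hΩ)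
  · refine Set.iUnion₂_subset fun Ω hΩ => ?_
    rw [← e] at hΩ
    obtain ⟨φ, h1, h2, rfl⟩ := hΩ
    intro m hm
    obtain ⟨y, hy, rfl⟩ := (mem_alpha_combo (fun p => p.convex) φ.support φ id).1 hm
    refine sum_mem (isConvex_closure _) _ _ _ h2 fun Ω hΩ h0 => ?_
    refine hDA Ω (h1 hΩ) ?_
    rw [hD']
    exact hy Ω hΩ h0

/-- The multiplication of the monad. -/
noncomputable def join {X : Type u} (A : FGConvex S (FGConvex S X)) : FGConvex S X where
  carrier := joinSet S A.carrier
  convex := joinSet_convex A.convex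
  fg := by
    obtain ⟨B, hB, e⟩ := A.fg
    exact joinSet_fg A.convex hB e

theorem mem_join {X : Type u} {A : FGConvex S (FGConvex S X)} {m : X →₀ S} :
    m ∈ A.join.carrier ↔ ∃ Ω ∈ A.carrier, m ∈ alphaSet S carrier Ω := by
  simp only [join, joinSet, Set.mem_iUnion, exists_prop]

theorem mem_alpha_mapDomain {X : Type u} {P : Type*} (g : P → FGConvex S X) (Ω : P →₀ S)
    {m : X →₀ S} : m ∈ alphaSet S carrier (Ω.mapDomain g) ↔
      ∃ y : P → (X →₀ S), (∀ p ∈ Ω.support, y p ∈ (g p).carrier) ∧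
        m = ∑ p ∈ Ω.support, Ω p • y p := by
  rw [Finsupp.mapDomain, Finsupp.sum, mem_alpha_sum (fun p => p.convex)]
  refine exists_congr fun y => and_congr_left fun _ => forall₂_congr fun p hp => ?_
  exact ⟨fun h => h (Finsupp.mem_support_iff.1 hp), fun h _ => h⟩

theorem join_map_map {X Y : Type u} (f : X → Y) (A : FGConvex S (FGConvex S X)) :
    (A.map (map f)).join = A.join.map f := by
  classical
  ext m
  rw [mem_join]
  have hlin : ∀ (Ω : FGConvex S X →₀ S) (y : FGConvex S X → (X →₀ S)),
      ∑ p ∈ Ω.support, Ω p • (y p).mapDomain f =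
        (∑ p ∈ Ω.support, Ω p • y p).mapDomain f := by
    intro Ω y
    rw [Finsupp.mapDomain_finsetSum]
    exact Finset.sum_congr rfl fun p _ => (Finsupp.mapDomain_smul _ _).symm
  constructor
  · rintro ⟨_, ⟨Ω, hΩ, rfl⟩, hm⟩
    obtain ⟨y, hy, rfl⟩ := (mem_alpha_mapDomain _ _).1 hm
    have : ∀ p : FGConvex S X, ∃ z : X →₀ S,
        p ∈ Ω.support → z ∈ p.carrier ∧ z.mapDomain f = y p := by
      intro p
      by_cases hp : p ∈ Ω.support
      · obtain ⟨z, hz⟩ := hy p hp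
        exact ⟨z, fun _ => hz⟩
      · exact ⟨0, fun h => absurd h hp⟩
    choose z hz using this
    refine ⟨∑ p ∈ Ω.support, Ω p • z p,
      mem_join.2 ⟨Ω, hΩ, mem_alpha.2 ⟨z, fun p hp => (hz p hp).1, rfl⟩⟩, ?_⟩
    rw [← hlin]
    exact Finset.sum_congr rfl fun p hp => by rw [(hz p hp).2]
  · rintro ⟨n, hn, rfl⟩
    obtain ⟨Ω, hΩ, hn⟩ := mem_join.1 hn
    obtain ⟨w, hw, rfl⟩ := mem_alpha.1 hn
    refine ⟨_, ⟨Ω, hΩ, rfl⟩, (mem_alpha_mapDomain _ _).2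
      ⟨fun p => (w p).mapDomain f, fun p hp => ⟨w p, hw p hp, rfl⟩, (hlin Ω w).symm⟩⟩

theorem join_map_join {X : Type u} (A : FGConvex S (FGConvex S (FGConvex S X))) :
    (A.map join).join = A.join.join := by
  classical
  ext m
  rw [mem_join, mem_join]
  constructor
  · rintro ⟨_, ⟨Ω, hΩ, rfl⟩, hm⟩
    obtain ⟨y, hy, rfl⟩ := (mem_alpha_mapDomain _ _).1 hm
    have : ∀ p : FGConvex S (FGConvex S X), ∃ v : FGConvex S X →₀ S,
        p ∈ Ω.support → v ∈ p.carrier ∧ y p ∈ alphaSet S carrier v := by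
      intro p
      by_cases hp : p ∈ Ω.support
      · obtain ⟨v, hv⟩ := mem_join.1 (hy p hp)
        exact ⟨v, fun _ => hv⟩
      · exact ⟨0, fun h => absurd h hp⟩
    choose v hv using this
    refine ⟨∑ p ∈ Ω.support, Ω p • v p,
      mem_join.2 ⟨Ω, hΩ, mem_alpha.2 ⟨v, fun p hp => (hv p hp).1, rfl⟩⟩, ?_⟩
    exact (mem_alpha_combo (fun p => p.convex) _ _ _).2 ⟨y, fun p hp _ => (hv p hp).2, rfl⟩
  · rintro ⟨Θ, hΘ, hm⟩
    obtain ⟨Ω, hΩ, hΘ⟩ := mem_join.1 hΘ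
    obtain ⟨v, hv, rfl⟩ := mem_alpha.1 hΘ
    obtain ⟨y, hy, rfl⟩ := (mem_alpha_combo (fun p => p.convex) _ _ _).1 hm
    refine ⟨_, ⟨Ω, hΩ, rfl⟩, (mem_alpha_mapDomain _ _).2 ⟨y, fun p hp => ?_, rfl⟩⟩
    exact mem_join.2 ⟨v p, hv p hp, hy p hp (Finsupp.mem_support_iff.1 hp)⟩

theorem join_pure {X : Type u} (A : FGConvex S X) : (pure A : FGConvex S (FGConvex S X)).join = A := by
  classical
  ext m
  rw [mem_join]
  have key : m ∈ alphaSet S carrier (Finsupp.single A (1 : S)) ↔ m ∈ A.carrier := by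
    have e : Finsupp.single A (1 : S) = ∑ i ∈ ({()} : Finset Unit), Finsupp.single A (1 : S) := by
      simp
    rw [e, mem_alpha_sum (fun p => p.convex)]
    by_cases h : (1 : S) = 0
    · have hS : Subsingleton S := subsingleton_of_zero_eq_one h.symm
      have hm : m = 0 := Subsingleton.elim _ _
      have : m ∈ A.carrier := by
        rw [← A.convex]
        exact ⟨0, by simp, by simp [h], Subsingleton.elim _ _⟩
      exact ⟨fun _ => this, fun _ => ⟨fun _ => 0, fun _ _ h' => absurd h h', Subsingleton.elim _ _⟩⟩
    · constructor
      · rintro ⟨y, hy, rfl⟩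
        simpa using hy () (by simp) h
      · exact fun hm => ⟨fun _ => m, fun _ _ _ => hm, by simp⟩
  constructor
  · rintro ⟨_, rfl, hm⟩
    exact key.1 hm
  · exact fun hm => ⟨_, rfl, key.2 hm⟩

theorem join_map_pure {X : Type u} (A : FGConvex S X) : (A.map pure).join = A := by
  classical
  ext m
  rw [mem_join]
  have hφ : ∀ φ : X →₀ S, φ = ∑ x ∈ φ.support, φ x • Finsupp.single x 1 := by
    intro φ
    conv_lhs => rw [← Finsupp.sum_single φ]
    exact Finset.sum_congr rfl fun x _ => by simp
  constructor
  · rintro ⟨_, ⟨φ, h, rfl⟩, hm⟩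
    obtain ⟨y, hy, rfl⟩ := (mem_alpha_mapDomain _ _).1 hm
    have : ∑ x ∈ φ.support, φ x • y x = φ := by
      conv_rhs => rw [hφ φ]
      exact Finset.sum_congr rfl fun x hx => by rw [show y x = _ from hy x hx]
    rwa [this]
  · exact fun hm => ⟨_, ⟨m, hm, rfl⟩, (mem_alpha_mapDomain _ _).2
      ⟨fun x => Finsupp.single x 1, fun _ _ => rfl, hφ m⟩⟩

end FGConvex

/-- The monad of finitely generated convex subsets of free `S`-semimodules. -/
noncomputable def fgConvexMonad (S : Type u) [Semiring S] [PositiveSemifield S] :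
    CategoryTheory.Monad (Type u) where
  obj X := FGConvex S X
  map f := ↾(FGConvex.map (S := S) f)
  map_id X := by
    refine ConcreteCategory.hom_ext _ _ fun A => ?_
    change FGConvex.map id A = A
    apply FGConvex.ext
    change Finsupp.mapDomain id '' A.carrier = A.carrier
    simp [Finsupp.mapDomain_id]
  map_comp f g := by
    refine ConcreteCategory.hom_ext _ _ fun A => ?_
    change FGConvex.map (g ∘ f) A = FGConvex.map g (FGConvex.map f A)
    apply FGConvex.ext
    change Finsupp.mapDomain (g ∘ f) '' A.carrier =
      Finsupp.mapDomain g '' (Finsupp.mapDomain f '' A.carrier)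
    rw [Set.image_image]
    exact Set.image_congr fun φ _ => Finsupp.mapDomain_comp
  η :=
    { app := fun X => ↾(FGConvex.pure (S := S) (X := X))
      naturality := by
        intro X Y f
        refine ConcreteCategory.hom_ext _ _ fun x => ?_
        change FGConvex.pure (f x) = FGConvex.map f (FGConvex.pure (S := S) x)
        apply FGConvex.ext
        change {_} = Finsupp.mapDomain f '' {_}
        rw [Set.image_singleton, Finsupp.mapDomain_single] }
  μ :=
    { app := fun X => ↾(FGConvex.join (S := S) (X := X))
      naturality := by
        intro X Y f
        refine ConcreteCategory.hom_ext _ _ fun A => ?_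
        exact FGConvex.join_map_map (S := S) f A }
  assoc X := by
    refine ConcreteCategory.hom_ext _ _ fun A => ?_
    exact FGConvex.join_map_join A
  left_unit X := by
    refine ConcreteCategory.hom_ext _ _ fun A => ?_
    exact FGConvex.join_pure A
  right_unit X := by
    refine ConcreteCategory.hom_ext _ _ fun A => ?_
    exact FGConvex.join_map_pure A

/-! For every algebraic theory, the Eilenberg–Moore algebras of its term monad are its algebras, and
an isomorphism of monads induces an isomorphism of their categories of algebras (`presents_of_iso`).
So everything reduces to the isomorphism of monads.

The finitely generated convex subsets of the free semimodule on `X` form an algebra of the theory: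
joins are closures of unions, sums are Minkowski sums, scalars act elementwise, except that `0 • A =
{0}` even for empty `A`. The delicate law is `(r + t) • A = r • A + t • A`, which needs convexity,
positivity and division (`add_smul_of_ne_zero`). Evaluating terms there, with variables sent to
Dirac singletons, gives `toConvex`.

The inverse `ofConvex` sends the closure of a finite set `B` to the join of the linear combinations
named by the elements of `B`. It does not depend on `B`: distributivity makes the operations
monotone, so a convex combination of elements below `b` is below `(∑ r i) • b = b` (`sum_smul_le`).
Hence passing to convex combinations does not change a join.

Both maps preserve the operations and match the generators, hence they are mutually inverse.
Compatibility with the monad structures follows because images and `FGConvex.join` preserve the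
operations too (`map_smul`, `join_add`, `join_smul` and their companions), so both sides of each
equation are evaluations that agree on variables. -/

/-! ## Eilenberg-Moore algebras -/

namespace CategoryTheory.Monad

variable {C : Type*} [Category* C]

/-- An isomorphism of categories requires equality of functors, and `Functor.hext` asks for
heterogeneous equality on morphisms; this reduces it to the underlying morphisms. -/
theorem Algebra.hom_heq {M : Monad C} {A A' B B' : M.Algebra} (hA : A = A') (hB : B = B')
    {f : A ⟶ B} {g : A' ⟶ B'} (h : f.f ≍ g.f) : f ≍ g := by
  subst hA hB
  exact heq_of_eq (Algebra.Hom.ext (eq_of_heq h))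

theorem Algebra.ext_of_heq {M : Monad C} {A B : M.Algebra} (hA : A.A = B.A) (ha : A.a ≍ B.a) :
    A = B := by
  cases A; cases B
  obtain rfl : _ = _ := hA
  obtain rfl := eq_of_heq ha
  rfl

/-- Pulling back along `f` and then `g` keeps the carrier and precomposes the structure map with `g
≫ f`. -/
theorem algebraFunctorOfMonadHom_comp_eq_id {M N : Monad C} {f : M ⟶ N} {g : N ⟶ M}
    (h : g ≫ f = 𝟙 N) :
    algebraFunctorOfMonadHom f ⋙ algebraFunctorOfMonadHom g = 𝟭 N.Algebra := by
  have hobj : ∀ A, (algebraFunctorOfMonadHom f ⋙ algebraFunctorOfMonadHom g).obj A =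
      (𝟭 N.Algebra).obj A := by
    intro A
    refine Algebra.ext_of_heq rfl (heq_of_eq ?_)
    change g.app A.A ≫ f.app A.A ≫ A.a = A.a
    have := congrArg (fun k : N ⟶ N => k.app A.A) h
    change g.app A.A ≫ f.app A.A = 𝟙 _ at this
    rw [← Category.assoc, this, Category.id_comp]
  exact Functor.hext hobj fun A B k => Algebra.hom_heq (hobj A) (hobj B) HEq.rfl

end CategoryTheory.Monad

/-! ### Algebras of a theory and algebras of its term monad. -/

namespace AlgTheory

open FirstOrder.Language (Structure)

variable {T : AlgTheory.{u}}

@[ext]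
theorem Alg.hom_ext {A B : T.Alg} {f g : A ⟶ B}
    (h : ∀ a, (show A.carrier →[T.sig] B.carrier from f) a =
      (show A.carrier →[T.sig] B.carrier from g) a) : f = g :=
  FirstOrder.Language.Hom.ext h

theorem Alg.hom_heq {A A' B B' : T.Alg} (hA : A = A') (hB : B = B') {f : A ⟶ B} {g : A' ⟶ B'}
    (h : (show A.carrier →[T.sig] B.carrier from f).toFun ≍
      (show A'.carrier →[T.sig] B'.carrier from g).toFun) : f ≍ g := by
  subst hA hB
  exact heq_of_eq (Alg.hom_ext (congrFun (eq_of_heq h)))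

theorem Alg.ext_of_funMap {A : Type u} {s t : T.sig.Structure A}
    (hs : @Satisfies T A s) (ht : @Satisfies T A t)
    (h : ∀ (n : ℕ) (o : T.sig.Functions n) (v : Fin n → A), s.funMap o v = t.funMap o v) :
    (⟨A, s, hs⟩ : T.Alg) = ⟨A, t, ht⟩ := by
  obtain rfl : s = t := by
    refine Structure.ext ?_ ?_
    · funext n o v
      exact h n o v
    · funext n r
      exact (T.algebraic n).elim r
  rfl

/-- A function between algebras that preserves the operations is a homomorphism. -/
def homOfFunMap {A B : Type u} [T.sig.Structure A] [T.sig.Structure B] (f : A → B)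
    (h : ∀ (n : ℕ) (o : T.sig.Functions n) (v : Fin n → A),
      f (Structure.funMap o v) = Structure.funMap o (f ∘ v)) : A →[T.sig] B where
  toFun := f
  map_fun' o v := h _ o v
  map_rel' r := (T.algebraic _).elim r

theorem FreeAlg.eval_map {X Y A : Type u} [T.sig.Structure A] (hA : T.Satisfies A) (f : X → Y)
    (v : Y → A) (a : T.FreeAlg X) : eval hA v (map f a) = eval hA (v ∘ f) a := by
  induction a using FreeAlg.ind with
  | var x => rfl
  | func n o ts ih => simp only [map_funMap, eval_funMap, ih]

/-- Both sides preserve the operations and agree on variables. The compatibility of `toConvex` with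
renaming and substitution rests on this. -/
theorem FreeAlg.hom_eval {X A B : Type u} [T.sig.Structure A] [T.sig.Structure B]
    (hA : T.Satisfies A) (hB : T.Satisfies B) (f : A → B)
    (hf : ∀ (n : ℕ) (o : T.sig.Functions n) (v : Fin n → A),
      f (Structure.funMap o v) = Structure.funMap o (f ∘ v))
    (v : X → A) (a : T.FreeAlg X) : f (eval hA v a) = eval hB (f ∘ v) a := by
  induction a using FreeAlg.ind with
  | var x => rfl
  | func n o ts ih =>
    simp only [eval_funMap, hf]
    congr 1
    funext i
    exact ih i

/-- Since `join` is itself an evaluation and `eval hA v` preserves the operations, this is an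
instance of `hom_eval`. -/
theorem FreeAlg.eval_join {X A : Type u} [T.sig.Structure A] (hA : T.Satisfies A)
    (v : X → A) (a : T.FreeAlg (T.FreeAlg X)) : eval hA v (join a) = eval hA (eval hA v) a :=
  hom_eval (satisfies X) hA _ (fun _ o ts => eval_funMap hA v o ts) _ a

section AlgebraOfMonad

variable (A : T.termMonad.Algebra)

/-- The structure map of an Eilenberg-Moore algebra of the term monad, as a function. -/
def emEval : T.FreeAlg A.A → A.A := A.a

theorem emEval_var (x : A.A) : emEval A (.mk (.var x)) = x :=
  ConcreteCategory.congr_hom A.unit x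

theorem emEval_join (a : T.FreeAlg (T.FreeAlg A.A)) :
    emEval A (FreeAlg.join a) = emEval A (FreeAlg.map (emEval A) a) :=
  ConcreteCategory.congr_hom A.assoc a

/-- The operations on an Eilenberg-Moore algebra of the term monad. -/
@[reducible]
def emStructure : T.sig.Structure A.A where
  funMap o v := emEval A (.mk (.func o fun i => .var (v i)))
  RelMap r := (T.algebraic _).elim r

/-- This is associativity of the structure map at the one-layer term `o` whose variables are the
classes `ts i`. -/
theorem emEval_funMap {n : ℕ} (o : T.sig.Functions n) (ts : Fin n → T.FreeAlg A.A) :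
    emEval A (Structure.funMap o ts) =
      emEval A (.mk (.func o fun i => .var (emEval A (ts i)))) := by
  have h := emEval_join A (FreeAlg.mk (.func o fun i => .var (ts i)))
  exact h

theorem emStructure_satisfies : @Satisfies T A.A (emStructure A) := by
  let := emStructure A
  -- Realization in `A.A` factors through the free algebra, where the equations hold by
  -- construction.
  have key : ∀ (v : ℕ → A.A) (t : T.sig.Term ℕ),
      t.realize v = emEval A (t.realize fun n => (FreeAlg.mk (.var (v n)) : T.FreeAlg A.A)) := by
    intro v t
    induction t with
    | var n => exact (emEval_var A _).symm
    | func o ts ih =>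
      simp only [FirstOrder.Language.Term.realize_func, ih]
      exact (emEval_funMap A o _).symm
  intro e he v
  rw [key, key, FreeAlg.satisfies A.A e he]

/-- The structure map is recovered from the operations it induces, by induction on terms; this gives
one of the two round trips on objects. -/
theorem emEval_eq_eval (a : T.FreeAlg A.A) :
    @FreeAlg.eval T A.A A.A (emStructure A) (emStructure_satisfies A) id a = emEval A a := by
  let := emStructure A
  induction a using FreeAlg.ind with
  | var x => exact (emEval_var A x).symm
  | func n o ts ih =>
    rw [FreeAlg.eval_funMap, emEval_funMap]
    simp only [ih]
    rfl

theorem emEval_hom {A B : T.termMonad.Algebra} (f : A ⟶ B) (a : T.FreeAlg A.A) :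
    f.f (emEval A a) = emEval B (FreeAlg.map f.f a) :=
  (ConcreteCategory.congr_hom f.h a).symm

end AlgebraOfMonad

variable (T)

/-- Eilenberg-Moore algebras of the term monad are algebras of the theory. -/
def algOfTermMonad : T.termMonad.Algebra ⥤ T.Alg where
  obj A := ⟨A.A, emStructure A, emStructure_satisfies A⟩
  map {A B} f := @homOfFunMap T A.A B.A (emStructure A) (emStructure B) f.f fun n o v =>
    emEval_hom f (FreeAlg.mk (.func o fun i => .var (v i)))

/-- Algebras of the theory are Eilenberg-Moore algebras of the term monad. -/
noncomputable def termMonadOfAlg : T.Alg ⥤ T.termMonad.Algebra where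
  obj A :=
    { A := A.carrier
      a := ↾(FreeAlg.eval A.sat id)
      unit := rfl
      assoc := by
        refine ConcreteCategory.hom_ext _ _ fun a => ?_
        exact (FreeAlg.eval_join A.sat id a).trans (FreeAlg.eval_map A.sat _ id a).symm }
  map {A B} f :=
    { f := ↾(show A.carrier →[T.sig] B.carrier from f)
      h := by
        refine ConcreteCategory.hom_ext _ _ fun a => ?_
        exact (FreeAlg.eval_map B.sat _ id a).trans (FreeAlg.hom_eval A.sat B.sat _
          (fun n o v => FirstOrder.Language.Hom.map_fun _ o v) id a).symm }

theorem algOfTermMonad_comp : T.algOfTermMonad ⋙ T.termMonadOfAlg = 𝟭 _ := by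
  have hobj : ∀ A, (T.algOfTermMonad ⋙ T.termMonadOfAlg).obj A =
      (𝟭 T.termMonad.Algebra).obj A := fun A =>
    Monad.Algebra.ext_of_heq rfl <| heq_of_eq <| ConcreteCategory.hom_ext _ _ (emEval_eq_eval A)
  exact Functor.hext hobj fun A B f => Monad.Algebra.hom_heq (hobj A) (hobj B) HEq.rfl

/-- Evaluating the one-layer term `o` at the elements `v i` returns `o v` by definition, so this
round trip is immediate on operations. -/
theorem termMonadOfAlg_comp : T.termMonadOfAlg ⋙ T.algOfTermMonad = 𝟭 _ := by
  have hobj : ∀ A, (T.termMonadOfAlg ⋙ T.algOfTermMonad).obj A = (𝟭 T.Alg).obj A := fun A =>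
    Alg.ext_of_funMap _ A.sat fun _ _ _ => rfl
  exact Functor.hext hobj fun A B f => Alg.hom_heq (hobj A) (hobj B) HEq.rfl

/-- Eilenberg–Moore algebras are contravariant in the monad: `e.hom` turns algebras of `M` into
algebras of the term monad, and `e.inv` goes back. -/
theorem presents_of_iso {M : CategoryTheory.Monad (Type u)} (e : T.termMonad ≅ M) :
    T.Presents M := by
  refine ⟨Monad.algebraFunctorOfMonadHom e.hom ⋙ T.algOfTermMonad,
    T.termMonadOfAlg ⋙ Monad.algebraFunctorOfMonadHom e.inv, ?_, ?_, rfl⟩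
  · change Monad.algebraFunctorOfMonadHom e.hom ⋙ (T.algOfTermMonad ⋙ T.termMonadOfAlg) ⋙
      Monad.algebraFunctorOfMonadHom e.inv = _
    rw [algOfTermMonad_comp, Functor.id_comp,
      Monad.algebraFunctorOfMonadHom_comp_eq_id e.inv_hom_id]
  · change T.termMonadOfAlg ⋙ (Monad.algebraFunctorOfMonadHom e.inv ⋙
      Monad.algebraFunctorOfMonadHom e.hom) ⋙ T.algOfTermMonad = _
    rw [Monad.algebraFunctorOfMonadHom_comp_eq_id e.hom_inv_id, Functor.id_comp,
      termMonadOfAlg_comp]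

end AlgTheory

/-! ## Semilattices with a compatible semimodule structure -/

/-- A semilattice with bottom that is also a semimodule, subject to the distributivity axioms. -/
class ConvexSemilattice (S A : Type*) [Semiring S] [AddCommMonoid A] [Module S A]
    [SemilatticeSup A] [OrderBot A] : Prop where
  smul_bot : ∀ r : S, r ≠ 0 → r • (⊥ : A) = ⊥
  add_bot : ∀ a : A, a + ⊥ = ⊥
  smul_sup : ∀ (r : S) (a b : A), r • (a ⊔ b) = r • a ⊔ r • b
  add_sup : ∀ a b c : A, a + (b ⊔ c) = (a + b) ⊔ (a + c)

namespace ConvexSemilattice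

/-- Since `b ≤ c` means `b ⊔ c = c`, distributivity exhibits `a + c` as a join with `a + b` as one
member. -/
theorem add_le_add (S : Type*) {A : Type*} [Semiring S] [AddCommMonoid A] [Module S A]
    [SemilatticeSup A] [OrderBot A] [ConvexSemilattice S A]
    {a b c d : A} (h : a ≤ b) (h' : c ≤ d) : a + c ≤ b + d := by
  have key : ∀ a b c : A, b ≤ c → a + b ≤ a + c := fun a b c h => by
    rw [← sup_eq_right.2 h, add_sup (S := S)]
    exact le_sup_left
  calc a + c ≤ a + d := key _ _ _ h'
    _ = d + a := add_comm _ _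
    _ ≤ d + b := key _ _ _ h
    _ = b + d := add_comm _ _

theorem add_finsetSup (S : Type*) {A : Type*} [Semiring S] [AddCommMonoid A] [Module S A]
    [SemilatticeSup A] [OrderBot A] [ConvexSemilattice S A]
    {ι : Type*} (a : A) (s : Finset ι) (f : ι → A) :
    a + s.sup f = s.sup fun i => a + f i :=
  Finset.apply_sup_eq_sup_comp (a + ·) (add_sup (S := S) a) (add_bot (S := S) a)

theorem finsetSup_add_finsetSup (S : Type*) {A : Type*} [Semiring S] [AddCommMonoid A] [Module S A]
    [SemilatticeSup A] [OrderBot A] [ConvexSemilattice S A]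
    {ι κ : Type*} (s : Finset ι) (t : Finset κ) (f : ι → A)
    (g : κ → A) : s.sup f + t.sup g = (s ×ˢ t).sup fun p => f p.1 + g p.2 := by
  rw [Finset.sup_product_left, add_comm, add_finsetSup S]
  refine Finset.sup_congr rfl fun i _ => ?_
  rw [add_comm, add_finsetSup S]

variable {S A : Type*} [Semiring S] [AddCommMonoid A] [Module S A]
    [SemilatticeSup A] [OrderBot A] [ConvexSemilattice S A]

theorem smul_le_smul (r : S) {a b : A} (h : a ≤ b) : r • a ≤ r • b := by
  rw [← sup_eq_right.2 h, smul_sup]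
  exact le_sup_left

/-- By monotonicity the combination is at most `∑ r i • b = (∑ r i) • b = b`. This is how the axioms
force joins to absorb convex combinations. -/
theorem sum_smul_le {ι : Type*} (s : Finset ι) (r : ι → S) (a : ι → A) (b : A)
    (h1 : ∑ i ∈ s, r i = 1) (h : ∀ i ∈ s, a i ≤ b) : ∑ i ∈ s, r i • a i ≤ b := by
  classical
  have key : ∑ i ∈ s, r i • a i ≤ ∑ i ∈ s, r i • b := by
    clear h1
    induction s using Finset.induction_on with
    | empty => simp
    | insert i s hi ih =>
      rw [Finset.sum_insert hi, Finset.sum_insert hi]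
      exact add_le_add S (smul_le_smul _ (h i (Finset.mem_insert_self _ _)))
        (ih fun j hj => h j (Finset.mem_insert_of_mem hj))
  rwa [← Finset.sum_smul, h1, one_smul] at key

/-- The empty join is why `r ≠ 0` is needed: `0 • ⊥` is `0`, not `⊥`. -/
theorem smul_finsetSup {ι : Type*} {r : S} (hr : r ≠ 0) (s : Finset ι) (f : ι → A) :
    r • s.sup f = s.sup fun i => r • f i :=
  Finset.apply_sup_eq_sup_comp (r • ·) (smul_sup r) (smul_bot r hr)

end ConvexSemilattice

/-! ## The algebra of finitely generated convex sets -/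

namespace ConvexAux

variable {S : Type u} [Semiring S] {M : Type*} [AddCommMonoid M] [Module S M]

theorem closure_union_closure (A B : Set M) :
    convexClosure S (convexClosure S A ∪ convexClosure S B) = convexClosure S (A ∪ B) :=
  Set.Subset.antisymm
    (closure_subset (isConvex_closure _) (Set.union_subset (closure_mono Set.subset_union_left)
      (closure_mono Set.subset_union_right)))
    (closure_mono (Set.union_subset_union (subset_closure A) (subset_closure B)))

theorem alphaSet_zero {P : Type*} (c : P → Set M) : alphaSet S c 0 = {0} := by
  ext m
  simp [mem_alpha]

variable [PositiveSemifield S]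

/-- The one-term case of `mem_alpha_combo`. For `r = 0` the element `y` is unconstrained, as
`alphaSet S c 0` is `{0}` even when `alphaSet S c Ω` is empty. -/
theorem mem_alphaSet_smul {P : Type*} {c : P → Set M} (hc : ∀ p, IsConvex S (c p)) (r : S)
    (Ω : P →₀ S) {m : M} :
    m ∈ alphaSet S c (r • Ω) ↔ ∃ y, (r ≠ 0 → y ∈ alphaSet S c Ω) ∧ m = r • y := by
  have := mem_alpha_combo hc ({()} : Finset Unit) (fun _ => r) (fun _ => Ω) (m := m)
  simp only [Finset.sum_singleton] at this
  rw [this]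
  exact ⟨fun ⟨y, h, e⟩ => ⟨y (), h () (by simp), e⟩, fun ⟨y, h, e⟩ => ⟨fun _ => y, fun _ _ => h, e⟩⟩

/-- The two-term case of `mem_alpha_combo`, with both coefficients `1`. Where the supports overlap,
the right side allows two choices from the same set; convexity merges them into one. -/
theorem alphaSet_add [Nontrivial S] {P : Type*} {c : P → Set M} (hc : ∀ p, IsConvex S (c p))
    (Ω Ω' : P →₀ S) :
    alphaSet S c (Ω + Ω') = Set.image2 (· + ·) (alphaSet S c Ω) (alphaSet S c Ω') := by
  ext m
  have := mem_alpha_combo hc Finset.univ (fun _ : Fin 2 => (1 : S)) ![Ω, Ω'] (m := m)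
  simp only [Fin.sum_univ_two, one_smul, Finset.mem_univ, ne_eq, one_ne_zero, not_false_eq_true,
    forall_const, Fin.forall_fin_two, Matrix.cons_val_zero, Matrix.cons_val_one] at this
  rw [this]
  exact ⟨fun ⟨y, ⟨h, h'⟩, e⟩ => ⟨y 0, h, y 1, h', e.symm⟩,
    fun ⟨a, h, b, h', e⟩ => ⟨![a, b], ⟨h, h'⟩, e.symm⟩⟩

end ConvexAux

namespace FGConvex

open ConvexAux

variable {S : Type u} [Semiring S] {X Y : Type u}

theorem carrier_injective : Function.Injective (carrier : FGConvex S X → Set (X →₀ S)) :=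
  fun _ _ h => FGConvex.ext h

/-- The axioms of a positive semifield allow `1 = 0`. Then the empty combination has total weight
`1`, and every convex set is everything. -/
instance [Subsingleton S] : Subsingleton (FGConvex S X) where
  allEq A B := by
    have : ∀ A : FGConvex S X, A.carrier = Set.univ := by
      intro A
      refine Set.eq_univ_of_forall fun m => ?_
      rw [← A.convex]
      exact ⟨0, by simp, Subsingleton.elim _ _, Subsingleton.elim _ _⟩
    exact FGConvex.ext ((this A).trans (this B).symm)

/-- The convex closure of a finite set. -/
def span (B : Set (X →₀ S)) (hB : B.Finite) : FGConvex S X :=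
  ⟨convexClosure S B, isConvex_closure B, B, hB, rfl⟩

theorem exists_eq_span (A : FGConvex S X) :
    ∃ B : Finset (X →₀ S), A = span B B.finite_toSet := by
  obtain ⟨B, hB, e⟩ := A.fg
  refine ⟨hB.toFinset, FGConvex.ext ?_⟩
  change _ = convexClosure S (hB.toFinset : Set (X →₀ S))
  rw [hB.coe_toFinset, e]

/-! ### The operations on finitely generated convex sets. -/

instance : PartialOrder (FGConvex S X) := PartialOrder.lift _ carrier_injective

instance : SemilatticeSup (FGConvex S X) where
  sup A B :=
    { carrier := convexClosure S (A.carrier ∪ B.carrier)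
      convex := isConvex_closure _
      fg := by
        obtain ⟨D, hD, e⟩ := A.fg
        obtain ⟨D', hD', e'⟩ := B.fg
        exact ⟨D ∪ D', hD.union hD', by rw [← e, ← e', closure_union_closure]⟩ }
  le_sup_left A B := Set.subset_union_left.trans (subset_closure _)
  le_sup_right A B := Set.subset_union_right.trans (subset_closure _)
  sup_le A B C h h' := closure_subset C.convex (Set.union_subset h h')

instance : OrderBot (FGConvex S X) where
  -- The closure of `∅` is taken because `∅` itself is not convex when `1 = 0`.
  bot := span ∅ Set.finite_empty
  bot_le A := closure_subset A.convex (Set.empty_subset _)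

instance : Zero (FGConvex S X) where
  zero := ⟨{0}, closure_singleton 0, {0}, Set.finite_singleton _, closure_singleton 0⟩

instance : Add (FGConvex S X) where
  add A B :=
    { carrier := Set.image2 (· + ·) A.carrier B.carrier
      convex := by
        have := add_closure (S := S) A.carrier B.carrier
        rwa [A.convex, B.convex] at this
      fg := by
        obtain ⟨D, hD, e⟩ := A.fg
        obtain ⟨D', hD', e'⟩ := B.fg
        exact ⟨_, hD.image2 (· + ·) hD', by rw [add_closure, e, e']⟩ }

instance : AddCommMonoid (FGConvex S X) where
  add_assoc A B C := FGConvex.ext (Set.image2_assoc add_assoc)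
  add_comm A B := FGConvex.ext (Set.image2_comm add_comm)
  zero_add A := FGConvex.ext ((Set.image2_singleton_left).trans (by simp))
  add_zero A := FGConvex.ext ((Set.image2_singleton_right).trans (by simp))
  nsmul := nsmulRec

theorem carrier_sup (A B : FGConvex S X) :
    (A ⊔ B).carrier = convexClosure S (A.carrier ∪ B.carrier) := rfl

theorem carrier_bot : (⊥ : FGConvex S X).carrier = convexClosure S ∅ := rfl

theorem carrier_add (A B : FGConvex S X) :
    (A + B).carrier = Set.image2 (· + ·) A.carrier B.carrier := rfl

theorem carrier_zero : (0 : FGConvex S X).carrier = {0} := rfl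

theorem map_bot (f : X → Y) : (⊥ : FGConvex S X).map f = ⊥ := by
  apply FGConvex.ext
  change Finsupp.lmapDomain S S f '' convexClosure S ∅ = convexClosure S ∅
  rw [← closure_image, Set.image_empty]

theorem map_sup (f : X → Y) (A B : FGConvex S X) : (A ⊔ B).map f = A.map f ⊔ B.map f := by
  apply FGConvex.ext
  change Finsupp.lmapDomain S S f '' convexClosure S (A.carrier ∪ B.carrier) = _
  rw [← closure_image, Set.image_union]
  rfl

theorem map_zero (f : X → Y) : (0 : FGConvex S X).map f = 0 :=
  FGConvex.ext (Set.image_singleton.trans (by rw [Finsupp.mapDomain_zero]; rfl))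

theorem map_add (f : X → Y) (A B : FGConvex S X) : (A + B).map f = A.map f + B.map f :=
  FGConvex.ext (Set.image_image2_distrib fun _ _ => Finsupp.mapDomain_add)

theorem smul_carrier_eq {r : S} (hr : r ≠ 0) (A : Set (X →₀ S)) :
    {m | ∃ w, (r ≠ 0 → w ∈ A) ∧ m = r • w} = (fun m => r • m) '' A := by
  ext m
  exact ⟨fun ⟨w, h, e⟩ => ⟨w, h hr, e.symm⟩, fun ⟨w, h, e⟩ => ⟨w, fun _ => h, e.symm⟩⟩

theorem zero_smul_carrier_eq (A : Set (X →₀ S)) :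
    {m | ∃ w, ((0 : S) ≠ 0 → w ∈ A) ∧ m = (0 : S) • w} = {0} := by
  ext m
  simp

variable [PositiveSemifield S]

instance : SMul S (FGConvex S X) where
  smul r A :=
    -- The guard makes `0 • A = {0}` even when `A` is empty, as the equation `0 · x = 0` demands; a
    -- plain image would be empty.
    { carrier := {m | ∃ w, (r ≠ 0 → w ∈ A.carrier) ∧ m = r • w}
      convex := by
        by_cases hr : r = 0
        · subst hr
          rw [zero_smul_carrier_eq]
          exact closure_singleton 0
        · have := smul_closure hr A.carrier
          rw [A.convex] at this
          rwa [smul_carrier_eq hr]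
      fg := by
        by_cases hr : r = 0
        · subst hr
          rw [zero_smul_carrier_eq]
          exact ⟨{0}, Set.finite_singleton _, closure_singleton 0⟩
        · obtain ⟨D, hD, e⟩ := A.fg
          exact ⟨_, hD.image fun m => r • m, by rw [smul_closure hr, e, smul_carrier_eq hr]⟩ }

theorem mem_smul {r : S} {A : FGConvex S X} {m : X →₀ S} :
    m ∈ (r • A).carrier ↔ ∃ w, (r ≠ 0 → w ∈ A.carrier) ∧ m = r • w := Iff.rfl

theorem carrier_smul {r : S} (hr : r ≠ 0) (A : FGConvex S X) :
    (r • A).carrier = (fun m => r • m) '' A.carrier := smul_carrier_eq hr _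

theorem zero_smul' (A : FGConvex S X) : (0 : S) • A = 0 :=
  FGConvex.ext (zero_smul_carrier_eq _)

/-- A sum `r • w + t • w'` is `r + t` times a convex combination of `w` and `w'`, which lies in `A`
by convexity. The division is possible since positivity gives `r + t ≠ 0`. -/
theorem add_smul_of_ne_zero {r t : S} (hr : r ≠ 0) (ht : t ≠ 0) (A : FGConvex S X) :
    (r + t) • A = r • A + t • A := by
  have hrt : r + t ≠ 0 := fun h => hr (PositiveSemifield.positive _ _ h).1
  apply FGConvex.ext
  rw [carrier_add, carrier_smul hr, carrier_smul ht, carrier_smul hrt]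
  refine Set.Subset.antisymm ?_ ?_
  · rintro _ ⟨w, hw, rfl⟩
    exact ⟨_, ⟨w, hw, rfl⟩, _, ⟨w, hw, rfl⟩, (add_smul _ _ _).symm⟩
  · rintro _ ⟨_, ⟨w, hw, rfl⟩, _, ⟨w', hw', rfl⟩, rfl⟩
    obtain ⟨m, hm, e⟩ := exists_smul A.convex Finset.univ ![r, t] ![w, w'] (by simpa using hrt)
      fun i _ _ => by fin_cases i <;> assumption
    simp only [Fin.sum_univ_two, Matrix.cons_val_zero, Matrix.cons_val_one] at e
    exact ⟨m, hm, e.symm⟩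

theorem smul_zero' (r : S) : r • (0 : FGConvex S X) = 0 := by
  refine FGConvex.ext (Set.ext fun m => ?_)
  rw [mem_smul, carrier_zero]
  constructor
  · rintro ⟨w, hw, rfl⟩
    by_cases hr : r = 0
    · simp [hr]
    · simp [show w = 0 from hw hr]
  · rintro rfl
    exact ⟨0, fun _ => rfl, (smul_zero r).symm⟩

noncomputable instance : Module S (FGConvex S X) where
  zero_smul := zero_smul'
  smul_zero := smul_zero'
  one_smul A := by
    -- When `1 = 0`, the scalar `1` falls outside `carrier_smul`, but then all convex sets coincide.
    rcases subsingleton_or_nontrivial S with _ | _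
    · exact Subsingleton.elim _ _
    · exact FGConvex.ext ((carrier_smul one_ne_zero A).trans (by simp))
  mul_smul r t A := by
    by_cases hr : r = 0
    · rw [hr, zero_mul, zero_smul', zero_smul']
    by_cases ht : t = 0
    · rw [ht, mul_zero, zero_smul' A, smul_zero']
    · apply FGConvex.ext
      rw [carrier_smul (mul_ne_zero' hr ht), carrier_smul hr, carrier_smul ht, Set.image_image]
      simp only [mul_smul]
  smul_add r A B := by
    by_cases hr : r = 0
    · rw [hr, zero_smul', zero_smul', zero_smul', add_zero]
    · apply FGConvex.ext
      rw [carrier_add, carrier_smul hr, carrier_smul hr, carrier_smul hr, carrier_add]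
      exact Set.image_image2_distrib fun a b => smul_add r a b
  add_smul r t A := by
    by_cases hr : r = 0
    · rw [hr, zero_smul', zero_add, zero_add]
    by_cases ht : t = 0
    · rw [ht, zero_smul', add_zero, add_zero]
    exact add_smul_of_ne_zero hr ht A

/-- Minkowski sums and nonzero scalings commute with convex closure, so these laws reduce to images
of unions and of the empty set. -/
instance : ConvexSemilattice S (FGConvex S X) where
  smul_bot r hr := by
    apply FGConvex.ext
    rw [carrier_smul hr, carrier_bot, ← smul_closure hr, Set.image_empty]
  add_bot A := by
    apply FGConvex.ext
    rw [carrier_add, carrier_bot, ← A.convex, ← add_closure, Set.image2_empty_right]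
  smul_sup r A B := by
    by_cases hr : r = 0
    · rw [hr, zero_smul, zero_smul, zero_smul, sup_idem]
    · apply FGConvex.ext
      rw [carrier_smul hr, carrier_sup, carrier_sup, ← smul_closure hr, Set.image_union,
        carrier_smul hr, carrier_smul hr]
  add_sup A B C := by
    apply FGConvex.ext
    rw [carrier_add, carrier_sup, carrier_sup, carrier_add, carrier_add, ← Set.image2_union_right,
      add_closure, A.convex]

/-- The singletons form a linear map. -/
noncomputable def point : (X →₀ S) →ₗ[S] FGConvex S X where
  toFun φ := ⟨{φ}, closure_singleton φ, {φ}, Set.finite_singleton _, closure_singleton φ⟩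
  map_add' φ ψ := FGConvex.ext (by simp [carrier_add])
  map_smul' r φ := by
    by_cases hr : r = 0
    · subst hr
      refine FGConvex.ext ?_
      change {(0 : S) • φ} = ((0 : S) • _ : FGConvex S X).carrier
      rw [zero_smul, zero_smul, carrier_zero]
    · refine FGConvex.ext ?_
      change {r • φ} = (r • _ : FGConvex S X).carrier
      rw [carrier_smul hr, Set.image_singleton]

theorem point_single (x : X) : point (Finsupp.single x (1 : S)) = pure x := rfl

/-- With the linearity of `point`, this shows that the operations generate every finitely generated
convex set from the Dirac singletons. -/
theorem span_eq_sup (B : Finset (X →₀ S)) :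
    span (B : Set (X →₀ S)) B.finite_toSet = B.sup point := by
  refine le_antisymm (closure_subset (B.sup point).convex fun φ hφ => ?_)
    (Finset.sup_le fun φ hφ => ?_)
  · exact Finset.le_sup (f := point) hφ rfl
  · rintro _ rfl
    exact subset_closure _ hφ

/-! ### Images and joins are homomorphisms -/

theorem map_smul (f : X → Y) (r : S) (A : FGConvex S X) : (r • A).map f = r • A.map f := by
  by_cases hr : r = 0
  · rw [hr, zero_smul, zero_smul, map_zero]
  · apply FGConvex.ext
    change Finsupp.mapDomain f '' (r • A).carrier = _
    rw [carrier_smul hr, carrier_smul hr]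
    change _ = _ '' (Finsupp.mapDomain f '' A.carrier)
    rw [Set.image_image, Set.image_image]
    simp only [Finsupp.mapDomain_smul]

/-- By `mem_alpha_combo`, a choice for a convex combination of the `Ω` is a convex combination of
choices for each, so generators of `A` suffice. Joins and bottom are then handled by unions of
generating sets. -/
theorem carrier_join (A : FGConvex S (FGConvex S X)) {B : Set (FGConvex S X →₀ S)}
    (h : convexClosure S B = A.carrier) :
    A.join.carrier = convexClosure S (⋃ Ω ∈ B, alphaSet S carrier Ω) := by
  refine Set.Subset.antisymm ?_ (closure_subset A.join.convex ?_)
  · intro m hm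
    obtain ⟨Ω, hΩ, hm⟩ := mem_join.1 hm
    rw [← h] at hΩ
    obtain ⟨φ, h1, h2, rfl⟩ := hΩ
    obtain ⟨y, hy, rfl⟩ := (mem_alpha_combo (fun p => p.convex) φ.support φ id).1 hm
    exact sum_mem_closure _ _ _ h2 fun Ω hΩ h0 => Set.mem_biUnion (h1 hΩ) (hy Ω hΩ h0)
  · refine Set.iUnion₂_subset fun Ω hΩ m hm => mem_join.2 ⟨Ω, ?_, hm⟩
    rw [← h]
    exact subset_closure B hΩ

theorem join_bot : (⊥ : FGConvex S (FGConvex S X)).join = ⊥ := by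
  apply FGConvex.ext
  rw [carrier_join _ carrier_bot.symm, Set.biUnion_empty, carrier_bot]

theorem join_sup (A B : FGConvex S (FGConvex S X)) : (A ⊔ B).join = A.join ⊔ B.join := by
  apply FGConvex.ext
  rw [carrier_join _ (carrier_sup A B).symm, Set.biUnion_union]
  rfl

theorem join_zero : (0 : FGConvex S (FGConvex S X)).join = 0 := by
  refine FGConvex.ext ((Set.biUnion_singleton _ _).trans ?_)
  rw [alphaSet_zero, carrier_zero]

theorem join_add (A B : FGConvex S (FGConvex S X)) : (A + B).join = A.join + B.join := by
  rcases subsingleton_or_nontrivial S with _ | _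
  · exact Subsingleton.elim _ _
  refine FGConvex.ext (Set.ext fun m => ?_)
  rw [mem_join, carrier_add, carrier_add]
  constructor
  · rintro ⟨_, ⟨Ω, hΩ, Ω', hΩ', rfl⟩, hm⟩
    rw [alphaSet_add fun p => p.convex] at hm
    obtain ⟨a, ha, b, hb, rfl⟩ := hm
    exact ⟨a, mem_join.2 ⟨Ω, hΩ, ha⟩, b, mem_join.2 ⟨Ω', hΩ', hb⟩, rfl⟩
  · rintro ⟨a, ha, b, hb, rfl⟩
    obtain ⟨Ω, hΩ, ha⟩ := mem_join.1 ha
    obtain ⟨Ω', hΩ', hb⟩ := mem_join.1 hb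
    refine ⟨_, ⟨Ω, hΩ, Ω', hΩ', rfl⟩, ?_⟩
    rw [alphaSet_add fun p => p.convex]
    exact ⟨a, ha, b, hb, rfl⟩

theorem join_smul (r : S) (A : FGConvex S (FGConvex S X)) : (r • A).join = r • A.join := by
  by_cases hr : r = 0
  · rw [hr, zero_smul, zero_smul, join_zero]
  refine FGConvex.ext (Set.ext fun m => ?_)
  rw [mem_join, carrier_smul hr, carrier_smul hr]
  constructor
  · rintro ⟨_, ⟨Ω, hΩ, rfl⟩, hm⟩
    obtain ⟨y, hy, rfl⟩ := (mem_alphaSet_smul (fun p => p.convex) r Ω).1 hm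
    exact ⟨y, mem_join.2 ⟨Ω, hΩ, hy hr⟩, rfl⟩
  · rintro ⟨y, hy, rfl⟩
    obtain ⟨Ω, hΩ, hy⟩ := mem_join.1 hy
    exact ⟨_, ⟨Ω, hΩ, rfl⟩, (mem_alphaSet_smul (fun p => p.convex) r Ω).2 ⟨y, fun _ => hy, rfl⟩⟩

end FGConvex

/-! ## Algebras of the theory as convex semilattices -/

open FirstOrder.Language (Structure)

section ConvexStructure

variable {S : Type u} [Semiring S] {A B : Type*}

/-- The operations of a convex semilattice. -/
def convexOpMap [AddCommMonoid A] [Module S A] [SemilatticeSup A] [OrderBot A] :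
    ∀ {n : ℕ}, ConvexOp S n → (Fin n → A) → A
  | _, .bot, _ => ⊥
  | _, .sup, v => v 0 ⊔ v 1
  | _, .zero, _ => 0
  | _, .add, v => v 0 + v 1
  | _, .smul r, v => r • v 0

/-- A convex semilattice as a structure for the signature. -/
@[reducible]
def convexStructure [AddCommMonoid A] [Module S A] [SemilatticeSup A] [OrderBot A] :
    (convexTheory S).sig.Structure A where
  funMap := convexOpMap
  RelMap r := Empty.elim r

theorem convexStructure_satisfies (A : Type u) [AddCommMonoid A] [Module S A] [SemilatticeSup A]
    [OrderBot A] [ConvexSemilattice S A] :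
    @AlgTheory.Satisfies (convexTheory S) A convexStructure := by
  rintro ⟨_, _⟩ (h | h | h) v
  · cases h
    · exact sup_assoc _ _ _
    · exact sup_comm _ _
    · exact sup_bot_eq _
    · exact sup_idem _
  · cases h
    · exact add_assoc _ _ _
    · exact add_comm _ _
    · exact add_zero _
    · exact smul_zero _
    · exact zero_smul _ _
    · exact one_smul _ _
    · exact mul_smul _ _ _
    · exact smul_add _ _ _
    · exact add_smul _ _ _
  · cases h with
    | smul_bot r hr => exact ConvexSemilattice.smul_bot _ hr
    | add_bot => exact ConvexSemilattice.add_bot (S := S) _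
    | smul_sup r => exact ConvexSemilattice.smul_sup _ _ _
    | add_sup => exact ConvexSemilattice.add_sup (S := S) _ _ _

theorem map_convexOpMap [AddCommMonoid A] [Module S A] [SemilatticeSup A] [OrderBot A]
    [AddCommMonoid B] [Module S B] [SemilatticeSup B] [OrderBot B] {f : A → B} (bot : f ⊥ = ⊥)
    (sup : ∀ a b, f (a ⊔ b) = f a ⊔ f b) (zero : f 0 = 0) (add : ∀ a b, f (a + b) = f a + f b)
    (smul : ∀ (r : S) a, f (r • a) = r • f a) {n : ℕ} (o : ConvexOp S n) (v : Fin n → A) :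
    f (convexOpMap o v) = convexOpMap o (f ∘ v) := by
  cases o
  · exact bot
  · exact sup _ _
  · exact zero
  · exact add _ _
  · exact smul _ _

end ConvexStructure

/-! ## The free algebras of the theory -/

/-- The free algebra of the theory. -/
abbrev ConvexTerms (S : Type u) [Semiring S] (X : Type u) : Type u := (convexTheory S).FreeAlg X

namespace ConvexTerms

variable {S : Type u} [Semiring S] {X : Type u}

/-- The application of an operation symbol. -/
noncomputable def op {n : ℕ} (o : ConvexOp S n) (v : Fin n → ConvexTerms S X) : ConvexTerms S X :=
  Structure.funMap (L := (convexTheory S).sig) o v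

/-- A variable as an element of the free algebra. -/
def var (x : X) : ConvexTerms S X := AlgTheory.FreeAlg.mk (.var x)

/-! ### Realization of the axioms in the free algebra. -/

theorem realize_const (c : ConvexOp S 0) (v : ℕ → ConvexTerms S X) :
    FirstOrder.Language.Term.realize (L := (convexTheory S).sig) v
      (FirstOrder.Language.Constants.term (L := convexSig S) c) = op c ![] :=
  congrArg (op c) (Subsingleton.elim _ _)

theorem realize_unary (c : ConvexOp S 1) (s : (convexSig S).Term ℕ) (v : ℕ → ConvexTerms S X) :
    FirstOrder.Language.Term.realize (L := (convexTheory S).sig) v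
      (FirstOrder.Language.Functions.apply₁ (L := convexSig S) c s) =
    op c ![FirstOrder.Language.Term.realize (L := (convexTheory S).sig) v s] := by
  refine congrArg (op c) (funext fun i => ?_)
  rw [Subsingleton.elim i 0]
  rfl

theorem realize_binary (c : ConvexOp S 2) (s t : (convexSig S).Term ℕ)
    (v : ℕ → ConvexTerms S X) :
    FirstOrder.Language.Term.realize (L := (convexTheory S).sig) v
      (FirstOrder.Language.Functions.apply₂ (L := convexSig S) c s t) =
    op c ![FirstOrder.Language.Term.realize (L := (convexTheory S).sig) v s,
      FirstOrder.Language.Term.realize (L := (convexTheory S).sig) v t] := by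
  refine congrArg (op c) (funext fun i => ?_)
  fin_cases i <;> rfl

/-- The valuation of the variables `x`, `y`, `z`. -/
def valuation {A : Type*} (a b c : A) : ℕ → A
  | 0 => a
  | 1 => b
  | _ => c

theorem realize_eq {s t : (convexSig S).Term ℕ}
    (h : SemilatticeAx S s t ∨ SemimoduleAx S s t ∨ DistribAx S s t) (a b c : ConvexTerms S X) :
    FirstOrder.Language.Term.realize (L := (convexTheory S).sig) (valuation a b c) s =
      FirstOrder.Language.Term.realize (L := (convexTheory S).sig) (valuation a b c) t :=
  AlgTheory.FreeAlg.satisfies (T := convexTheory S) X (s, t) h _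

theorem realize_x (a b c : ConvexTerms S X) :
    FirstOrder.Language.Term.realize (L := (convexTheory S).sig) (valuation a b c)
      (ConvexTerm.x : (convexSig S).Term ℕ) = a := rfl

theorem realize_y (a b c : ConvexTerms S X) :
    FirstOrder.Language.Term.realize (L := (convexTheory S).sig) (valuation a b c)
      (ConvexTerm.y : (convexSig S).Term ℕ) = b := rfl

theorem realize_z (a b c : ConvexTerms S X) :
    FirstOrder.Language.Term.realize (L := (convexTheory S).sig) (valuation a b c)
      (ConvexTerm.z : (convexSig S).Term ℕ) = c := rfl

noncomputable instance : Zero (ConvexTerms S X) := ⟨op .zero ![]⟩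
noncomputable instance : Add (ConvexTerms S X) := ⟨fun a b => op .add ![a, b]⟩
noncomputable instance : SMul S (ConvexTerms S X) := ⟨fun r a => op (.smul r) ![a]⟩
noncomputable instance : Max (ConvexTerms S X) := ⟨fun a b => op .sup ![a, b]⟩
noncomputable instance : Bot (ConvexTerms S X) := ⟨op .bot ![]⟩

theorem realize_bot (v : ℕ → ConvexTerms S X) : FirstOrder.Language.Term.realize
    (L := (convexTheory S).sig) v (ConvexTerm.bot : (convexSig S).Term ℕ) = ⊥ :=
  realize_const _ v

theorem realize_zero (v : ℕ → ConvexTerms S X) : FirstOrder.Language.Term.realize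
    (L := (convexTheory S).sig) v (ConvexTerm.zero : (convexSig S).Term ℕ) = 0 :=
  realize_const _ v

theorem realize_sup (s t : (convexSig S).Term ℕ) (v : ℕ → ConvexTerms S X) :
    FirstOrder.Language.Term.realize (L := (convexTheory S).sig) v (ConvexTerm.sup s t) =
      FirstOrder.Language.Term.realize (L := (convexTheory S).sig) v s ⊔
        FirstOrder.Language.Term.realize (L := (convexTheory S).sig) v t :=
  realize_binary _ s t v

theorem realize_add (s t : (convexSig S).Term ℕ) (v : ℕ → ConvexTerms S X) :
    FirstOrder.Language.Term.realize (L := (convexTheory S).sig) v (ConvexTerm.add s t) =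
      FirstOrder.Language.Term.realize (L := (convexTheory S).sig) v s +
        FirstOrder.Language.Term.realize (L := (convexTheory S).sig) v t :=
  realize_binary _ s t v

theorem realize_smul (r : S) (s : (convexSig S).Term ℕ) (v : ℕ → ConvexTerms S X) :
    FirstOrder.Language.Term.realize (L := (convexTheory S).sig) v (ConvexTerm.smul r s) =
      r • FirstOrder.Language.Term.realize (L := (convexTheory S).sig) v s :=
  realize_unary _ s v

theorem op_eq_sup (v : Fin 2 → ConvexTerms S X) : op .sup v = v 0 ⊔ v 1 :=
  congrArg (op _) (funext fun i => by fin_cases i <;> rfl)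

theorem op_eq_add (v : Fin 2 → ConvexTerms S X) : op .add v = v 0 + v 1 :=
  congrArg (op _) (funext fun i => by fin_cases i <;> rfl)

theorem op_eq_smul (r : S) (v : Fin 1 → ConvexTerms S X) : op (.smul r) v = r • v 0 :=
  congrArg (op _) (funext fun i => by rw [Subsingleton.elim i 0]; rfl)

theorem op_eq_bot (v : Fin 0 → ConvexTerms S X) : op .bot v = ⊥ :=
  congrArg (op _) (Subsingleton.elim _ _)

theorem op_eq_zero (v : Fin 0 → ConvexTerms S X) : op .zero v = 0 :=
  congrArg (op _) (Subsingleton.elim _ _)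

/-! ### The free algebra is a convex semilattice. -/

theorem sup_assoc' (a b c : ConvexTerms S X) : a ⊔ b ⊔ c = a ⊔ (b ⊔ c) := by
  simpa only [realize_sup, realize_x, realize_y, realize_z] using realize_eq (.inl .assoc) a b c

theorem sup_comm' (a b : ConvexTerms S X) : a ⊔ b = b ⊔ a := by
  simpa only [realize_sup, realize_x, realize_y] using realize_eq (.inl .comm) a b a

theorem sup_idem' (a : ConvexTerms S X) : a ⊔ a = a := by
  simpa only [realize_sup, realize_x] using realize_eq (.inl .idem) a a a

theorem sup_bot' (a : ConvexTerms S X) : a ⊔ ⊥ = a := by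
  simpa only [realize_sup, realize_x, realize_bot] using realize_eq (.inl .unit) a a a

noncomputable instance : SemilatticeSup (ConvexTerms S X) :=
  SemilatticeSup.mk' sup_comm' sup_assoc' sup_idem'

noncomputable instance : OrderBot (ConvexTerms S X) where
  bot_le a := sup_eq_right.1 ((sup_comm _ _).trans (sup_bot' a))

theorem add_comm' (a b : ConvexTerms S X) : a + b = b + a := by
  simpa only [realize_add, realize_x, realize_y] using
    realize_eq (.inr (.inl .add_comm)) a b a

theorem add_zero' (a : ConvexTerms S X) : a + 0 = a := by
  simpa only [realize_add, realize_x, realize_zero] using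
    realize_eq (.inr (.inl .add_zero)) a a a

noncomputable instance : AddCommMonoid (ConvexTerms S X) where
  add_assoc a b c := by
    simpa only [realize_add, realize_x, realize_y, realize_z] using
      realize_eq (.inr (.inl .add_assoc)) a b c
  add_comm := add_comm'
  add_zero := add_zero'
  zero_add a := (add_comm' 0 a).trans (add_zero' a)
  nsmul := nsmulRec

noncomputable instance : Module S (ConvexTerms S X) where
  smul_zero r := by
    have := realize_eq (X := X) (.inr (.inl (.smul_zero r))) 0 0 0
    simpa only [realize_smul, realize_zero] using this
  zero_smul a := by
    simpa only [realize_smul, realize_x, realize_zero] using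
      realize_eq (.inr (.inl .zero_smul)) a a a
  one_smul a := by
    simpa only [realize_smul, realize_x] using realize_eq (.inr (.inl .one_smul)) a a a
  mul_smul r t a := by
    simpa only [realize_smul, realize_x] using realize_eq (.inr (.inl (.mul_smul r t))) a a a
  smul_add r a b := by
    simpa only [realize_smul, realize_add, realize_x, realize_y] using
      realize_eq (.inr (.inl (.smul_add r))) a b a
  add_smul r t a := by
    simpa only [realize_smul, realize_add, realize_x] using
      realize_eq (.inr (.inl (.add_smul r t))) a a a

instance : ConvexSemilattice S (ConvexTerms S X) where
  smul_bot r hr := by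
    have := realize_eq (X := X) (.inr (.inr (.smul_bot r hr))) 0 0 0
    simpa only [realize_smul, realize_bot] using this
  add_bot a := by
    simpa only [realize_add, realize_x, realize_bot] using
      realize_eq (.inr (.inr .add_bot)) a a a
  smul_sup r a b := by
    simpa only [realize_smul, realize_sup, realize_x, realize_y] using
      realize_eq (.inr (.inr (.smul_sup r))) a b a
  add_sup a b c := by
    simpa only [realize_add, realize_sup, realize_x, realize_y, realize_z] using
      realize_eq (.inr (.inr .add_sup)) a b c

theorem induction {p : ConvexTerms S X → Prop} (var : ∀ x, p (var x)) (bot : p ⊥)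
    (sup : ∀ a b, p a → p b → p (a ⊔ b)) (zero : p 0) (add : ∀ a b, p a → p b → p (a + b))
    (smul : ∀ (r : S) a, p a → p (r • a)) (a : ConvexTerms S X) : p a := by
  induction a using AlgTheory.FreeAlg.ind with
  | var x => exact var x
  | func n o ts ih =>
    change p (op o ts)
    cases (o : ConvexOp S n) with
    | bot => exact op_eq_bot ts ▸ bot
    | sup => exact op_eq_sup ts ▸ sup _ _ (ih 0) (ih 1)
    | zero => exact op_eq_zero ts ▸ zero
    | add => exact op_eq_add ts ▸ add _ _ (ih 0) (ih 1)
    | smul r => exact op_eq_smul r ts ▸ smul r _ (ih 0)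

/-! ### From convex sets to terms: joins of linear combinations. -/

/-- The linear extension of the inclusion of variables. -/
noncomputable def lin : (X →₀ S) →ₗ[S] ConvexTerms S X := Finsupp.linearCombination S var

theorem lin_single (x : X) : lin (Finsupp.single x (1 : S)) = var x := by
  rw [lin, Finsupp.linearCombination_single, one_smul]

/-- Linearity turns a convex combination of generators into one of terms, to which `sum_smul_le`
applies. -/
theorem lin_le_of_mem_closure {B : Set (X →₀ S)} {a : ConvexTerms S X}
    (h : ∀ φ ∈ B, lin φ ≤ a) {ψ : X →₀ S} (hψ : ψ ∈ convexClosure S B) : lin ψ ≤ a := by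
  obtain ⟨Φ, hΦ, h1, rfl⟩ := hψ
  rw [linComb, Finsupp.sum, map_sum]
  simp only [map_smul]
  exact ConvexSemilattice.sum_smul_le _ _ _ _ h1 fun φ hφ => h φ (hΦ hφ)

/-- The supremum of the linear combinations in a finitely generated convex set. -/
noncomputable def ofConvex (A : FGConvex S X) : ConvexTerms S X :=
  A.exists_eq_span.choose.sup lin

/-- Two finite sets with the same closure lie in each other's closure, so each join bounds the
other. This frees `ofConvex` from the generators that were chosen to define it. -/
theorem ofConvex_span (B : Finset (X →₀ S)) :
    ofConvex (FGConvex.span (B : Set (X →₀ S)) B.finite_toSet) = B.sup lin := by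
  have key : ∀ B D : Finset (X →₀ S), (B : Set (X →₀ S)) ⊆ convexClosure S (D : Set (X →₀ S)) →
      B.sup lin ≤ (D.sup lin : ConvexTerms S X) := fun B D h =>
    Finset.sup_le fun φ hφ => lin_le_of_mem_closure (fun ψ hψ => Finset.le_sup hψ) (h hφ)
  have e := congrArg FGConvex.carrier
    (FGConvex.span (B : Set (X →₀ S)) B.finite_toSet).exists_eq_span.choose_spec
  change convexClosure S _ = convexClosure S _ at e
  exact le_antisymm (key _ _ (e ▸ ConvexAux.subset_closure _))
    (key _ _ (e ▸ ConvexAux.subset_closure _))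

theorem ofConvex_of_carrier {A : FGConvex S X} {B : Finset (X →₀ S)}
    (h : A.carrier = convexClosure S (B : Set (X →₀ S))) : ofConvex A = B.sup lin := by
  rw [← ofConvex_span]
  exact congrArg ofConvex (FGConvex.ext h)

theorem ofConvex_pure (x : X) : ofConvex (FGConvex.pure (S := S) x) = var x := by
  rw [ofConvex_of_carrier (B := {Finsupp.single x 1}), Finset.sup_singleton, lin_single]
  rw [Finset.coe_singleton, ConvexAux.closure_singleton]
  rfl

theorem ofConvex_zero : ofConvex (0 : FGConvex S X) = 0 := by
  rw [ofConvex_of_carrier (B := {0}), Finset.sup_singleton, map_zero]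
  rw [Finset.coe_singleton, ConvexAux.closure_singleton]
  rfl

theorem ofConvex_bot : ofConvex (⊥ : FGConvex S X) = ⊥ := by
  rw [ofConvex_of_carrier (B := ∅), Finset.sup_empty]
  rw [Finset.coe_empty]
  rfl

theorem ofConvex_sup (A B : FGConvex S X) : ofConvex (A ⊔ B) = ofConvex A ⊔ ofConvex B := by
  classical
  obtain ⟨D, rfl⟩ := A.exists_eq_span
  obtain ⟨E, rfl⟩ := B.exists_eq_span
  rw [ofConvex_of_carrier (B := D ∪ E), Finset.sup_union, ofConvex_span, ofConvex_span]
  rw [Finset.coe_union]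
  exact ConvexAux.closure_union_closure _ _

/-- Pairwise sums of generators generate the Minkowski sum, and distributivity expands a sum of
joins over the same pairs. -/
theorem ofConvex_add (A B : FGConvex S X) : ofConvex (A + B) = ofConvex A + ofConvex B := by
  classical
  obtain ⟨D, rfl⟩ := A.exists_eq_span
  obtain ⟨E, rfl⟩ := B.exists_eq_span
  rw [ofConvex_of_carrier (B := (D ×ˢ E).image fun p => p.1 + p.2), Finset.sup_image,
    ofConvex_span, ofConvex_span, ConvexSemilattice.finsetSup_add_finsetSup S]
  · exact Finset.sup_congr rfl fun p _ => map_add lin p.1 p.2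
  · rw [Finset.coe_image, Finset.coe_product, Set.image_prod]
    exact (ConvexAux.add_closure _ _).symm

variable [PositiveSemifield S]

theorem ofConvex_smul (r : S) (A : FGConvex S X) : ofConvex (r • A) = r • ofConvex A := by
  classical
  -- Scaling generators fails for `r = 0`: an empty generating set stays empty, while `0 • A` is
  -- `0`.
  by_cases hr : r = 0
  · rw [hr, zero_smul, zero_smul, ofConvex_zero]
  obtain ⟨D, rfl⟩ := A.exists_eq_span
  rw [ofConvex_of_carrier (B := D.image fun φ => r • φ), Finset.sup_image, ofConvex_span,
    ConvexSemilattice.smul_finsetSup hr]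
  · exact Finset.sup_congr rfl fun φ _ => map_smul lin r φ
  · rw [Finset.coe_image, FGConvex.carrier_smul hr]
    exact (ConvexAux.smul_closure hr _).symm

/-! ### From terms to convex sets, and the two round trips. -/

noncomputable instance : (convexTheory S).sig.Structure (FGConvex S X) := convexStructure

theorem satisfies_fgConvex : (convexTheory S).Satisfies (FGConvex S X) :=
  convexStructure_satisfies (FGConvex S X)

/-- The finitely generated convex set denoted by a term. -/
noncomputable def toConvex : ConvexTerms S X → FGConvex S X :=
  AlgTheory.FreeAlg.eval satisfies_fgConvex FGConvex.pure

theorem toConvex_var (x : X) : toConvex (var x : ConvexTerms S X) = FGConvex.pure x := rfl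

theorem toConvex_bot : toConvex (⊥ : ConvexTerms S X) = ⊥ :=
  AlgTheory.FreeAlg.eval_funMap (T := convexTheory S) _ _ (ConvexOp.bot : ConvexOp S 0) _

theorem toConvex_sup (a b : ConvexTerms S X) : toConvex (a ⊔ b) = toConvex a ⊔ toConvex b :=
  AlgTheory.FreeAlg.eval_funMap (T := convexTheory S) _ _ (ConvexOp.sup : ConvexOp S 2) _

theorem toConvex_zero : toConvex (0 : ConvexTerms S X) = 0 :=
  AlgTheory.FreeAlg.eval_funMap (T := convexTheory S) _ _ (ConvexOp.zero : ConvexOp S 0) _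

theorem toConvex_add (a b : ConvexTerms S X) : toConvex (a + b) = toConvex a + toConvex b :=
  AlgTheory.FreeAlg.eval_funMap (T := convexTheory S) _ _ (ConvexOp.add : ConvexOp S 2) _

theorem toConvex_smul (r : S) (a : ConvexTerms S X) : toConvex (r • a) = r • toConvex a :=
  AlgTheory.FreeAlg.eval_funMap (T := convexTheory S) _ _ (ConvexOp.smul r : ConvexOp S 1) _

/-- Both maps preserve the operations and match variables with Dirac singletons. This is
completeness: terms that denote the same convex set are provably equal. -/
theorem ofConvex_toConvex (a : ConvexTerms S X) : ofConvex (toConvex a) = a := by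
  induction a using ConvexTerms.induction with
  | var x => exact ofConvex_pure x
  | bot => rw [toConvex_bot, ofConvex_bot]
  | sup a b ha hb => rw [toConvex_sup, ofConvex_sup, ha, hb]
  | zero => rw [toConvex_zero, ofConvex_zero]
  | add a b ha hb => rw [toConvex_add, ofConvex_add, ha, hb]
  | smul r a ha => rw [toConvex_smul, ofConvex_smul, ha]

/-- Both sides are linear in `φ`, and a linear map on a free semimodule is determined by its values
at Dirac functions. -/
theorem toConvex_lin (φ : X →₀ S) : toConvex (lin φ) = FGConvex.point φ := by
  let f : ConvexTerms S X →ₗ[S] FGConvex S X :=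
    { toFun := toConvex, map_add' := toConvex_add, map_smul' := toConvex_smul }
  have : f ∘ₗ lin = FGConvex.point := by
    ext1 x
    ext1
    change toConvex (lin (Finsupp.single x 1)) = FGConvex.point (Finsupp.single x 1)
    rw [lin_single, FGConvex.point_single, toConvex_var]
  exact LinearMap.congr_fun this φ

theorem toConvex_ofConvex (A : FGConvex S X) : toConvex (ofConvex A) = A := by
  obtain ⟨B, rfl⟩ := A.exists_eq_span
  rw [ofConvex_span, FGConvex.span_eq_sup,
    Finset.apply_sup_eq_sup_comp toConvex toConvex_sup toConvex_bot]
  exact Finset.sup_congr rfl fun φ _ => toConvex_lin φ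

/-! ### Compatibility with renaming and substitution. -/

/-- Taking images preserves the operations, so both sides evaluate `a` with the variable `x` sent to
the Dirac singleton at `f x`. -/
theorem toConvex_map {Y : Type u} (f : X → Y) (a : ConvexTerms S X) :
    toConvex (AlgTheory.FreeAlg.map f a : ConvexTerms S Y) = (toConvex a).map f := by
  refine (AlgTheory.FreeAlg.eval_map _ f _ a).trans ?_
  refine Eq.trans ?_ (AlgTheory.FreeAlg.hom_eval satisfies_fgConvex satisfies_fgConvex
    (FGConvex.map f) (fun n o v => map_convexOpMap (FGConvex.map_bot f) (FGConvex.map_sup f)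
      (FGConvex.map_zero f) (FGConvex.map_add f) (FGConvex.map_smul f) o v) _ a).symm
  congr 1
  funext x
  apply FGConvex.ext
  change {_} = Finsupp.mapDomain f '' {_}
  rw [Set.image_singleton, Finsupp.mapDomain_single]

/-- Both sides are evaluations of `a`, since `FGConvex.join` preserves the operations. The
valuations are `toConvex` and its composite with `pure` and then `join`, which agree by the unit law
`join_pure`. -/
theorem toConvex_join (a : ConvexTerms S (ConvexTerms S X)) :
    toConvex (AlgTheory.FreeAlg.join a : ConvexTerms S X) =
      (toConvex (AlgTheory.FreeAlg.map toConvex a : ConvexTerms S (FGConvex S X))).join := by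
  have hop : ∀ (n : ℕ) (o : ConvexOp S n) (v : Fin n → FGConvex S (FGConvex S X)),
      (convexOpMap o v).join = convexOpMap o (FGConvex.join ∘ v) := fun n o v =>
    map_convexOpMap (A := FGConvex S (FGConvex S X)) (B := FGConvex S X) (f := FGConvex.join)
      (by exact FGConvex.join_bot) FGConvex.join_sup FGConvex.join_zero FGConvex.join_add
      FGConvex.join_smul o v
  have hom : ∀ b : ConvexTerms S (FGConvex S X), (toConvex b).join =
      AlgTheory.FreeAlg.eval satisfies_fgConvex (FGConvex.join ∘ FGConvex.pure) b :=
    AlgTheory.FreeAlg.hom_eval satisfies_fgConvex satisfies_fgConvex FGConvex.join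
      hop _
  rw [hom, AlgTheory.FreeAlg.eval_map, toConvex, AlgTheory.FreeAlg.eval_join]
  congr 1
  funext x
  exact (FGConvex.join_pure _).symm

end ConvexTerms

/-- The term monad of the theory is the monad of finitely generated convex sets. -/
noncomputable def termMonadIso (S : Type u) [Semiring S] [PositiveSemifield S] :
    (convexTheory S).termMonad ≅ fgConvexMonad S :=
  MonadIso.mk
    (NatIso.ofComponents
      (fun X =>
        { hom := ↾(ConvexTerms.toConvex (S := S) (X := X))
          inv := ↾(ConvexTerms.ofConvex (S := S) (X := X))
          hom_inv_id := ConcreteCategory.hom_ext _ _ ConvexTerms.ofConvex_toConvex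
          inv_hom_id := ConcreteCategory.hom_ext _ _ ConvexTerms.toConvex_ofConvex })
      fun f => ConcreteCategory.hom_ext _ _ (ConvexTerms.toConvex_map f))
    (fun _ => rfl)
    fun _ => ConcreteCategory.hom_ext _ _ ConvexTerms.toConvex_join

theorem mainTheorem5 (S : Type u) [Semiring S] [PositiveSemifield S] :
    Nonempty ((convexTheory S).termMonad ≅ fgConvexMonad S) ∧
      (convexTheory S).Presents (fgConvexMonad S) :=
  ⟨⟨termMonadIso S⟩, AlgTheory.presents_of_iso _ (termMonadIso S)⟩
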